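/- **Conventions.** Bicategories are not assumed strict. A morphism $e: X\to Y$ of a bicategory is an *internal equivalence* if there are a morphism $e': Y\to X$ and invertible 2-morphisms $\mathrm{id}_X\Rightarrow e'\circ e$ and $e\circ e'\Rightarrow \mathrm{id}_Y$. For bicategories $\mathscr C,\mathscr D$, pseudofunctors $\mathscr C\to\mathscr D$, pseudonatural transformations and modifications form a bicategory; a *pseudonatural equivalence* is an internal equivalence of it. **Axioms (BF).** Let $\mathscr C$ be a bicategory and $\mathbf W$ a class of morphisms of $\mathscr C$. The pair $(\mathscr C,\mathbf W)$ satisfies conditions (BF) if: * (BF1) every identity morphism belongs to $\mathbf W$; * (BF2) if $v: A\to B$ and $w: B\to C$ belong to $\mathbf W$, so does $w\circ v$; * (BF3) for every $w: A\to B$ in $\mathbf W$ and every $f: C\to B$ there are $w': D\to C$ in $\mathbf W$, $f': D\to A$ and an invertible 2-morphism $f\circ w'\Rightarrow w\circ f'$; * (BF4) for every $w: B\to A$ in $\mathbf W$, all $f_1,f_2: C\to B$ and every 2-morphism $\alpha: w\circ f_1\Rightarrow w\circ f_2$, call a *lift* of $\alpha$ a triple $(D,v,\beta)$ with $v: D\to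 C$ in $\mathbf W$ and $\beta: f_1\circ v\Rightarrow f_2\circ v$ such that $\alpha * v$ equals $w*\beta$ up to associators; then (a) $\alpha$ has a lift; (b) if $\alpha$ is invertible, it has a lift with $\beta$ invertible; (c) for any two lifts $(D,v,\beta)$, $(D',v',\beta')$ of $\alpha$ there are $s: E\to D$, $s': E\to D'$ and an invertible $\zeta: v\circ s\Rightarrow v'\circ s'$ such that $v\circ s\in\mathbf W$ and, up to associators, $(\beta'*s')\odot(f_1*\zeta)=(f_2*\zeta)\odot(\beta*s)$; * (BF5) if $w\in\mathbf W$ and there is an invertible 2-morphism $v\Rightarrow w$, then $v\in\mathbf W$. **Saturation.** The (right) saturation $\mathbf W_{\mathrm{sat}}$ is the class of all morphisms $f: B\to A$ for which there are morphisms $g: C\to B$ and $h: D\to C$ such that both $f\circ g$ and $g\circ h$ belong to $\mathbf W$. **Bicategory of fractions.** $U_{\mathbf W}:\mathscr C\to\mathscr C[\mathbf W^{-1}]$ denotes the bicategory of fractions: $U_{\mathbf W}$ is a pseudofunctor that sends each element of $\mathbf W$ to an internal equivalence and is universal with this property, that is, for every bicategory $\mathscr D$ composition with $U_{\mathbf W}$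 is an equivalence from the bicategory of pseudofunctors $\mathscr C[\mathbf W^{-1}]\to\mathscr D$ to that of the pseudofunctors $\mathscr C\to\mathscr D$ sending each element of $\mathbf W$ to an internal equivalence. This determines it up to equivalence of bicategories; concretely one may take for $\mathscr C[\mathbf W^{-1}]$ the bicategory obtained from $\mathscr C$ by freely adjoining a quasi-inverse (with invertible unit and counit satisfying the triangle identities) to every element of $\mathbf W$. **Cylinders.** For a bicategory $\mathscr D$, the bicategory of cylinders $\mathrm{Cyl}(\mathscr D)$ has as objects the morphisms of $\mathscr D$. A morphism from $x: X_1\to X_2$ to $y: Y_1\to Y_2$ is a triple of $f_1: X_1\to Y_1$, $f_2: X_2\to Y_2$ and a 2-morphism $\varphi: y\circ f_1\Rightarrow f_2\circ x$. A 2-morphism $(f_1,f_2,\varphi)\Rightarrow(g_1,g_2,\psi)$ is a pair $\eta_i: f_i\Rightarrow g_i$ ($i=1,2$) with $\psi\odot(y*\eta_1)=(\eta_2*x)\odot\varphi$. Morphisms are composed by pasting. A pseudonatural transformation $\kappa: F\Rightarrow G$ between pseudofunctors $\mathscr A\to\mathscr D$ is the same as a pseudofunctor $\mu_\kappa:\mathscr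 A\to\mathrm{Cyl}(\mathscr D)$ given on objects by $A\mapsto\kappa_A$ and on morphisms by $f\mapsto(F(f),G(f),\kappa_f)$. **Theorem.** Let $(\mathscr A,\mathbf W_{\mathscr A})$ and $(\mathscr B,\mathbf W_{\mathscr B})$ be pairs satisfying conditions (BF), and let $F:\mathscr A\to\mathscr B$ be a pseudofunctor. Then the following are equivalent: 1. $F(\mathbf W_{\mathscr A})\subseteq\mathbf W_{\mathscr B,\mathrm{sat}}$; 2. $F(\mathbf W_{\mathscr A,\mathrm{sat}})\subseteq\mathbf W_{\mathscr B,\mathrm{sat}}$; 3. there are a pseudofunctor $G:\mathscr A[\mathbf W_{\mathscr A}^{-1}]\to\mathscr B[\mathbf W_{\mathscr B}^{-1}]$ and a pseudonatural equivalence $\kappa: U_{\mathbf W_{\mathscr B}}\circ F\Rightarrow G\circ U_{\mathbf W_{\mathscr A}}$; 4. there is a pair $(G,\kappa)$ as in (3) such that the pseudofunctor $\mu_\kappa:\mathscr A\to\mathrm{Cyl}(\mathscr B[\mathbf W_{\mathscr B}^{-1}])$ associated to $\kappa$ sends each element of $\mathbf W_{\mathscr A}$ to an internal equivalence. -/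

import Mathlib

open CategoryTheory CategoryTheory.Bicategory
open scoped CategoryTheory.Pseudofunctor.StrongTrans

universe w v u w₁ v₁ u₁ w₂ v₂ u₂

namespace BicatFractions

section Basic

variable {C : Type u} [Bicategory.{w, v} C]

/-- A 1-morphism `e` is an *internal equivalence* if there is a 1-morphism `e'` backwards together
with invertible 2-morphisms `𝟙 ≅ e ≫ e'` and `e' ≫ e ≅ 𝟙`. -/
def IsInternalEquivalence {a b : C} (e : a ⟶ b) : Prop :=
  ∃ e' : b ⟶ a, Nonempty (𝟙 a ≅ e ≫ e') ∧ Nonempty (e' ≫ e ≅ 𝟙 b)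

/-- A quasi-inverse of `e` together with unit and counit making up an adjoint equivalence. -/
structure AdjointInverse {a b : C} (e : a ⟶ b) where
  inv : b ⟶ a
  unit : 𝟙 a ≅ e ≫ inv
  counit : inv ≫ e ≅ 𝟙 b
  triangle : leftZigzag unit.hom counit.hom = (λ_ e).hom ≫ (ρ_ e).inv

namespace AdjointInverse

variable {a b : C} {e : a ⟶ b}

/-- The adjunction underlying an adjoint equivalence. -/
def adj (i : AdjointInverse e) : e ⊣ i.inv where
  unit := i.unit.hom
  counit := i.counit.hom
  left_triangle := i.triangle
  right_triangle := right_triangle_of_left_triangle _ _ i.triangle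

theorem isInternalEquivalence (i : AdjointInverse e) : IsInternalEquivalence e :=
  ⟨i.inv, ⟨i.unit⟩, ⟨i.counit⟩⟩

theorem nonempty (h : IsInternalEquivalence e) : Nonempty (AdjointInverse e) := by
  obtain ⟨e', ⟨η⟩, ⟨θ⟩⟩ := h
  exact ⟨⟨e', η, adjointifyCounit η θ, congrArg Iso.hom (adjointifyCounit_left_triangle η θ)⟩⟩

end AdjointInverse

/-- The conditions (BF1)–(BF5) for a right bicalculus of fractions.
Composition is written in diagrammatic order: `f ≫ g` is `g ∘ f`. -/
structure SatisfiesBF (W : MorphismProperty C) : Prop where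
  /-- (BF1) identities belong to `W` -/
  bf1 : ∀ a : C, W (𝟙 a)
  /-- (BF2) `W` is closed under composition -/
  bf2 : ∀ {a b c : C} (f : a ⟶ b) (g : b ⟶ c), W f → W g → W (f ≫ g)
  /-- (BF3) every cospan with one leg in `W` can be completed to a square, commuting up to an
  invertible 2-morphism, whose opposite side is in `W` -/
  bf3 : ∀ {a b c : C} (w : a ⟶ b) (f : c ⟶ b), W w →
    ∃ (d : C) (w' : d ⟶ c) (f' : d ⟶ a), W w' ∧ Nonempty (w' ≫ f ≅ f' ≫ w)
  /-- (BF4a) 2-morphisms `α : w ∘ f₁ ⟶ w ∘ f₂` lift along `w`, after precomposition with some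
  `v` in `W` -/
  bf4a : ∀ {a b c : C} (w : b ⟶ a) (f₁ f₂ : c ⟶ b) (α : f₁ ≫ w ⟶ f₂ ≫ w), W w →
    ∃ (d : C) (v : d ⟶ c) (β : v ≫ f₁ ⟶ v ≫ f₂), W v ∧
      v ◁ α = (α_ v f₁ w).inv ≫ β ▷ w ≫ (α_ v f₂ w).hom
  /-- (BF4b) if `α` is invertible, the lift can be chosen invertible -/
  bf4b : ∀ {a b c : C} (w : b ⟶ a) (f₁ f₂ : c ⟶ b) (α : f₁ ≫ w ⟶ f₂ ≫ w), W w → IsIso α →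
    ∃ (d : C) (v : d ⟶ c) (β : v ≫ f₁ ⟶ v ≫ f₂), W v ∧ IsIso β ∧
      v ◁ α = (α_ v f₁ w).inv ≫ β ▷ w ≫ (α_ v f₂ w).hom
  /-- (BF4c) any two such lifts `(d, v, β)` and `(d', v', β')` agree after further
  precomposition -/
  bf4c : ∀ {a b c : C} (w : b ⟶ a) (f₁ f₂ : c ⟶ b) (α : f₁ ≫ w ⟶ f₂ ≫ w), W w →
    ∀ {d d' : C} (v : d ⟶ c) (β : v ≫ f₁ ⟶ v ≫ f₂) (v' : d' ⟶ c) (β' : v' ≫ f₁ ⟶ v' ≫ f₂),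
      W v → W v' →
      v ◁ α = (α_ v f₁ w).inv ≫ β ▷ w ≫ (α_ v f₂ w).hom →
      v' ◁ α = (α_ v' f₁ w).inv ≫ β' ▷ w ≫ (α_ v' f₂ w).hom →
      ∃ (e : C) (s : e ⟶ d) (s' : e ⟶ d') (ζ : s ≫ v ≅ s' ≫ v'), W (s ≫ v) ∧
        ζ.hom ▷ f₁ ≫ (α_ s' v' f₁).hom ≫ s' ◁ β' ≫ (α_ s' v' f₂).inv =
          (α_ s v f₁).hom ≫ s ◁ β ≫ (α_ s v f₂).inv ≫ ζ.hom ▷ f₂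
  /-- (BF5) `W` is closed under invertible 2-morphisms -/
  bf5 : ∀ {a b : C} (v w : a ⟶ b), (v ≅ w) → W w → W v

/-- The (right) saturation of `W`: all `f : b ⟶ a` for which there are `g : c ⟶ b`, `h : d ⟶ c`
such that `f ∘ g` and `g ∘ h` belong to `W`. -/
def rightSaturation (W : MorphismProperty C) : MorphismProperty C := fun b _ f =>
  ∃ (c d : C) (g : c ⟶ b) (h : d ⟶ c), W (g ≫ f) ∧ W (h ≫ g)

end Basic

/-! ### The bicategory of cylinders -/

section Cyl

variable (D : Type u) [Bicategory.{w, v} D]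

/-- Objects of the bicategory of cylinders in `D`: the 1-morphisms of `D`. -/
structure Cyl where
  src : D
  tgt : D
  mor : src ⟶ tgt

variable {D}

namespace Cyl

/-- A 1-morphism of cylinders from `s` to `t` is a square of 1-morphisms filled with a (not
necessarily invertible) 2-morphism `t.mor ∘ fst ⟶ snd ∘ s.mor`. -/
structure Hom (s t : Cyl D) where
  fst : s.src ⟶ t.src
  snd : s.tgt ⟶ t.tgt
  cell : fst ≫ t.mor ⟶ s.mor ≫ snd

/-- A 2-morphism of cylinders is a pair of 2-morphisms compatible with the fillers. -/
@[ext]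
structure Hom₂ {s t : Cyl D} (f g : Hom s t) where
  fst : f.fst ⟶ g.fst
  snd : f.snd ⟶ g.snd
  comm : fst ▷ t.mor ≫ g.cell = f.cell ≫ s.mor ◁ snd

instance : CategoryStruct (Cyl D) where
  Hom := Hom
  id s := ⟨𝟙 s.src, 𝟙 s.tgt, (λ_ s.mor).hom ≫ (ρ_ s.mor).inv⟩
  comp f g := ⟨f.fst ≫ g.fst, f.snd ≫ g.snd,
    (α_ _ _ _).hom ≫ f.fst ◁ g.cell ≫ (α_ _ _ _).inv ≫ f.cell ▷ g.snd ≫ (α_ _ _ _).hom⟩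

@[simp] lemma id_fst (s : Cyl D) : Hom.fst (𝟙 s) = 𝟙 s.src := rfl
@[simp] lemma id_snd (s : Cyl D) : Hom.snd (𝟙 s) = 𝟙 s.tgt := rfl
@[simp] lemma id_cell (s : Cyl D) : Hom.cell (𝟙 s) = (λ_ s.mor).hom ≫ (ρ_ s.mor).inv := rfl
@[simp] lemma comp_fst {s t r : Cyl D} (f : s ⟶ t) (g : t ⟶ r) :
    Hom.fst (f ≫ g) = Hom.fst f ≫ Hom.fst g := rfl
@[simp] lemma comp_snd {s t r : Cyl D} (f : s ⟶ t) (g : t ⟶ r) :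
    Hom.snd (f ≫ g) = Hom.snd f ≫ Hom.snd g := rfl
@[simp] lemma comp_cell {s t r : Cyl D} (f : s ⟶ t) (g : t ⟶ r) :
    Hom.cell (f ≫ g) = (α_ _ _ _).hom ≫ Hom.fst f ◁ Hom.cell g ≫ (α_ _ _ _).inv ≫
      Hom.cell f ▷ Hom.snd g ≫ (α_ _ _ _).hom := rfl

instance homCategory (s t : Cyl D) : Category (s ⟶ t) where
  Hom f g := Hom₂ f g
  id f := ⟨𝟙 _, 𝟙 _, by simp⟩
  comp η θ := ⟨η.fst ≫ θ.fst, η.snd ≫ θ.snd, by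
    simp [θ.comm, reassoc_of% η.comm]⟩
  id_comp η := by apply Hom₂.ext <;> simp
  comp_id η := by apply Hom₂.ext <;> simp
  assoc η θ ι := by apply Hom₂.ext <;> simp

@[simp] lemma id₂_fst {s t : Cyl D} (f : s ⟶ t) : Hom₂.fst (𝟙 f) = 𝟙 (Hom.fst f) := rfl
@[simp] lemma id₂_snd {s t : Cyl D} (f : s ⟶ t) : Hom₂.snd (𝟙 f) = 𝟙 (Hom.snd f) := rfl
@[simp] lemma comp₂_fst {s t : Cyl D} {f g h : s ⟶ t} (η : f ⟶ g) (θ : g ⟶ h) :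
    Hom₂.fst (η ≫ θ) = Hom₂.fst η ≫ Hom₂.fst θ := rfl
@[simp] lemma comp₂_snd {s t : Cyl D} {f g h : s ⟶ t} (η : f ⟶ g) (θ : g ⟶ h) :
    Hom₂.snd (η ≫ θ) = Hom₂.snd η ≫ Hom₂.snd θ := rfl

lemma hom₂_ext {s t : Cyl D} {f g : s ⟶ t} {η θ : f ⟶ g} (h₁ : Hom₂.fst η = Hom₂.fst θ)
    (h₂ : Hom₂.snd η = Hom₂.snd θ) : η = θ := Hom₂.ext h₁ h₂

/-- An invertible 2-morphism of cylinders from a compatible pair of invertible 2-morphisms. -/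
def mkIso {s t : Cyl D} {f g : s ⟶ t} (α : Hom.fst f ≅ Hom.fst g) (β : Hom.snd f ≅ Hom.snd g)
    (comm : α.hom ▷ t.mor ≫ Hom.cell g = Hom.cell f ≫ s.mor ◁ β.hom) : f ≅ g where
  hom := ⟨α.hom, β.hom, comm⟩
  inv := ⟨α.inv, β.inv, by
    rw [← cancel_epi (α.hom ▷ t.mor), reassoc_of% comm]; simp⟩
  hom_inv_id := hom₂_ext (by simp) (by simp)
  inv_hom_id := hom₂_ext (by simp) (by simp)

@[simp] lemma mkIso_hom_fst {s t : Cyl D} {f g : s ⟶ t} (α : Hom.fst f ≅ Hom.fst g)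
    (β : Hom.snd f ≅ Hom.snd g) (comm) :
    Hom₂.fst (mkIso (f := f) (g := g) α β comm).hom = α.hom := rfl
@[simp] lemma mkIso_hom_snd {s t : Cyl D} {f g : s ⟶ t} (α : Hom.fst f ≅ Hom.fst g)
    (β : Hom.snd f ≅ Hom.snd g) (comm) :
    Hom₂.snd (mkIso (f := f) (g := g) α β comm).hom = β.hom := rfl
@[simp] lemma mkIso_inv_fst {s t : Cyl D} {f g : s ⟶ t} (α : Hom.fst f ≅ Hom.fst g)
    (β : Hom.snd f ≅ Hom.snd g) (comm) :
    Hom₂.fst (mkIso (f := f) (g := g) α β comm).inv = α.inv := rfl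
@[simp] lemma mkIso_inv_snd {s t : Cyl D} {f g : s ⟶ t} (α : Hom.fst f ≅ Hom.fst g)
    (β : Hom.snd f ≅ Hom.snd g) (comm) :
    Hom₂.snd (mkIso (f := f) (g := g) α β comm).inv = β.inv := rfl

/-- Left whiskering of 2-morphisms of cylinders. -/
def whiskerL {s t r : Cyl D} (f : s ⟶ t) {g h : t ⟶ r} (η : g ⟶ h) : f ≫ g ⟶ f ≫ h :=
  Hom₂.mk (f := f ≫ g) (g := f ≫ h) (Hom.fst f ◁ Hom₂.fst η) (Hom.snd f ◁ Hom₂.snd η) (by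
    have := Hom₂.comm η
    calc
      _ = (α_ _ _ _).hom ≫ Hom.fst f ◁ (Hom₂.fst η ▷ r.mor ≫ Hom.cell h) ≫ (α_ _ _ _).inv ≫
            Hom.cell f ▷ Hom.snd h ≫ (α_ _ _ _).hom := by simp
      _ = (α_ _ _ _).hom ≫ Hom.fst f ◁ Hom.cell g ≫ (α_ _ _ _).inv ≫
            ((Hom.fst f ≫ t.mor) ◁ Hom₂.snd η ≫ Hom.cell f ▷ Hom.snd h) ≫ (α_ _ _ _).hom := by
          rw [this]; simp
      _ = _ := by rw [whisker_exchange]; simp)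

/-- Right whiskering of 2-morphisms of cylinders. -/
def whiskerR {s t r : Cyl D} {f g : s ⟶ t} (η : f ⟶ g) (h : t ⟶ r) : f ≫ h ⟶ g ≫ h :=
  Hom₂.mk (f := f ≫ h) (g := g ≫ h) (Hom₂.fst η ▷ Hom.fst h) (Hom₂.snd η ▷ Hom.snd h) (by
    have := Hom₂.comm η
    calc
      _ = (α_ _ _ _).hom ≫ (Hom₂.fst η ▷ _ ≫ Hom.fst g ◁ Hom.cell h) ≫ (α_ _ _ _).inv ≫
            Hom.cell g ▷ Hom.snd h ≫ (α_ _ _ _).hom := by simp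
      _ = (α_ _ _ _).hom ≫ Hom.fst f ◁ Hom.cell h ≫ (α_ _ _ _).inv ≫
            (Hom₂.fst η ▷ t.mor ≫ Hom.cell g) ▷ Hom.snd h ≫ (α_ _ _ _).hom := by
          rw [← whisker_exchange]; simp
      _ = _ := by rw [this]; simp)

@[simp] lemma whiskerL_fst {s t r : Cyl D} (f : s ⟶ t) {g h : t ⟶ r} (η : g ⟶ h) :
    Hom₂.fst (whiskerL f η) = Hom.fst f ◁ Hom₂.fst η := rfl
@[simp] lemma whiskerL_snd {s t r : Cyl D} (f : s ⟶ t) {g h : t ⟶ r} (η : g ⟶ h) :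
    Hom₂.snd (whiskerL f η) = Hom.snd f ◁ Hom₂.snd η := rfl
@[simp] lemma whiskerR_fst {s t r : Cyl D} {f g : s ⟶ t} (η : f ⟶ g) (h : t ⟶ r) :
    Hom₂.fst (whiskerR η h) = Hom₂.fst η ▷ Hom.fst h := rfl
@[simp] lemma whiskerR_snd {s t r : Cyl D} {f g : s ⟶ t} (η : f ⟶ g) (h : t ⟶ r) :
    Hom₂.snd (whiskerR η h) = Hom₂.snd η ▷ Hom.snd h := rfl

/-- The bicategory of cylinders in `D`. -/
instance bicategory : Bicategory (Cyl D) where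
  homCategory s t := homCategory s t
  whiskerLeft f _ _ η := whiskerL f η
  whiskerRight η h := whiskerR η h
  associator f g h := mkIso (f := (f ≫ g) ≫ h) (g := f ≫ g ≫ h) (α_ _ _ _) (α_ _ _ _) (by simp)
  leftUnitor {s _} f := mkIso (f := 𝟙 s ≫ f) (g := f) (λ_ _) (λ_ _) (by simp)
  rightUnitor {_ t} f := mkIso (f := f ≫ 𝟙 t) (g := f) (ρ_ _) (ρ_ _) (by simp)
  whiskerLeft_id _ _ := hom₂_ext (by simp) (by simp)
  whiskerLeft_comp _ _ _ _ _ _ := hom₂_ext (by simp) (by simp)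
  id_whiskerLeft _ := hom₂_ext (by simp) (by simp)
  comp_whiskerLeft _ _ _ _ _ := hom₂_ext (by simp) (by simp)
  id_whiskerRight _ _ := hom₂_ext (by simp) (by simp)
  comp_whiskerRight _ _ _ := hom₂_ext (by simp) (by simp)
  whiskerRight_id _ := hom₂_ext (by simp) (by simp)
  whiskerRight_comp _ _ _ := hom₂_ext (by simp) (by simp)
  whisker_assoc _ _ _ _ _ := hom₂_ext (by simp) (by simp)
  whisker_exchange _ _ := hom₂_ext (by simp [whisker_exchange]) (by simp [whisker_exchange])
  pentagon _ _ _ _ := hom₂_ext (by simp) (by simp)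
  triangle _ _ := hom₂_ext (by simp) (by simp)

end Cyl

variable {C : Type u₁} [Bicategory.{w₁, v₁} C]

/-- The pseudofunctor `μ_κ : C ⥤ Cyl D` associated to a pseudonatural transformation
`κ : F ⟶ G` between pseudofunctors `C ⥤ D`: it sends an object `a` to `κ.app a` and a
1-morphism `f` to the naturality square of `κ` at `f`. -/
def cylinderPseudofunctor {F G : C ⥤ᵖ D} (κ : F ⟶ G) : C ⥤ᵖ Cyl D where
  obj a := ⟨F.obj a, G.obj a, κ.app a⟩
  map f := Cyl.Hom.mk (F.map f) (G.map f) (κ.naturality f).hom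
  map₂ η := Cyl.Hom₂.mk (F.map₂ η) (G.map₂ η) (κ.naturality_naturality η)
  map₂_id _ := Cyl.hom₂_ext (by simp) (by simp)
  map₂_comp _ _ := Cyl.hom₂_ext (by simp) (by simp)
  mapId a := Cyl.mkIso (F.mapId a) (G.mapId a) (κ.naturality_id a).symm
  mapComp f g := Cyl.mkIso (F.mapComp f g) (G.mapComp f g) (κ.naturality_comp f g).symm
  map₂_whisker_left f _ _ η := Cyl.hom₂_ext (F.map₂_whisker_left f η) (G.map₂_whisker_left f η)
  map₂_whisker_right η h := Cyl.hom₂_ext (F.map₂_whisker_right η h) (G.map₂_whisker_right η h)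
  map₂_associator f g h := Cyl.hom₂_ext (F.map₂_associator f g h) (G.map₂_associator f g h)
  map₂_left_unitor f := Cyl.hom₂_ext (F.map₂_left_unitor f) (G.map₂_left_unitor f)
  map₂_right_unitor f := Cyl.hom₂_ext (F.map₂_right_unitor f) (G.map₂_right_unitor f)

end Cyl

/-! ### Restriction of pseudonatural transformations -/

section Restriction

variable {C : Type u} [Bicategory.{w, v} C] {L : Type u₁} [Bicategory.{w₁, v₁} L]
  {D : Type u₂} [Bicategory.{w₂, v₂} D]

/-- For a pseudofunctor `U : C ⥤ L`, the functor `σ ↦ σ ∘ U` from the category of pseudonatural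
transformations `G ⟶ G'` (and modifications) to that of pseudonatural transformations
`G ∘ U ⟶ G' ∘ U`. -/
def restriction (U : C ⥤ᵖ L) (G G' : L ⥤ᵖ D) : (G ⟶ G') ⥤ (U.comp G ⟶ U.comp G') where
  obj σ :=
    { app := fun a => σ.app (U.obj a)
      naturality := fun f => σ.naturality (U.map f)
      naturality_naturality := fun η => σ.naturality_naturality (U.map₂ η)
      naturality_id := fun a => (by
        rw [whiskerLeft_comp, ← σ.naturality_naturality_assoc, σ.naturality_id,
          comp_whiskerRight, Category.assoc] : (σ.naturality (U.map (𝟙 a))).hom ≫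
        σ.app (U.obj a) ◁ (G'.map₂ (U.mapId a).hom ≫ (G'.mapId (U.obj a)).hom) =
          (G.map₂ (U.mapId a).hom ≫ (G.mapId (U.obj a)).hom) ▷ σ.app (U.obj a) ≫
            (λ_ _).hom ≫ (ρ_ _).inv)
      naturality_comp := fun {a b c} f g => (by
        rw [whiskerLeft_comp, ← σ.naturality_naturality_assoc, σ.naturality_comp,
          comp_whiskerRight, Category.assoc] : (σ.naturality (U.map (f ≫ g))).hom ≫
        σ.app (U.obj a) ◁ (G'.map₂ (U.mapComp f g).hom ≫ (G'.mapComp (U.map f) (U.map g)).hom) =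
          (G.map₂ (U.mapComp f g).hom ≫ (G.mapComp (U.map f) (U.map g)).hom) ▷ σ.app (U.obj c) ≫
            (α_ _ _ _).hom ≫ G.map (U.map f) ◁ (σ.naturality (U.map g)).hom ≫ (α_ _ _ _).inv ≫
              (σ.naturality (U.map f)).hom ▷ G'.map (U.map g) ≫ (α_ _ _ _).hom) }
  map Γ := ⟨⟨fun a => Γ.as.app (U.obj a), fun f => Γ.as.naturality (U.map f)⟩⟩
  map_id _ := rfl
  map_comp _ _ := rfl

namespace AdjointInverse

/-- Pseudofunctors preserve adjoint quasi-inverses. -/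
def map (F : C ⥤ᵖ D) {a b : C} {e : a ⟶ b} (i : AdjointInverse e) : AdjointInverse (F.map e) where
  inv := F.map i.inv
  unit := (F.mapId a).symm ≪≫ F.map₂Iso i.unit ≪≫ F.mapComp e i.inv
  counit := (F.mapComp i.inv e).symm ≪≫ F.map₂Iso i.counit ≪≫ F.mapId b
  triangle := (F.mapAdjunction i.adj).left_triangle

theorem whiskerLeft_cancel {a b c : C} {e : a ⟶ b} (i : AdjointInverse e) {f g : b ⟶ c}
    {x y : f ⟶ g} (h : e ◁ x = e ◁ y) : x = y := by
  have key : ∀ z : f ⟶ g, z = (λ_ f).inv ≫ i.counit.inv ▷ f ≫ (α_ _ _ _).hom ≫ i.inv ◁ (e ◁ z) ≫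
      (α_ _ _ _).inv ≫ i.counit.hom ▷ g ≫ (λ_ g).hom := by
    intro z
    have : i.inv ◁ (e ◁ z) = (α_ _ _ _).inv ≫ (i.inv ≫ e) ◁ z ≫ (α_ _ _ _).hom := by simp
    rw [this]
    simp only [Category.assoc, Iso.hom_inv_id_assoc, whisker_exchange_assoc]
    rw [← comp_whiskerRight_assoc, Iso.inv_hom_id]
    simp
  rw [key x, key y, h]

variable {a b c d : C} {e₁ : a ⟶ b} {e₂ : c ⟶ d} {g : a ⟶ c} {h : b ⟶ d}

/-- The mate of an invertible square under two adjoint equivalences. -/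
def mate (i₁ : AdjointInverse e₁) (i₂ : AdjointInverse e₂) (n : e₁ ≫ h ≅ g ≫ e₂) :
    i₁.inv ≫ g ≅ h ≫ i₂.inv :=
  whiskerLeftIso _ ((ρ_ g).symm ≪≫ whiskerLeftIso g i₂.unit ≪≫ (α_ _ _ _).symm ≪≫
    whiskerRightIso n.symm _ ≪≫ (α_ _ _ _)) ≪≫ (α_ _ _ _).symm ≪≫
    whiskerRightIso i₁.counit _ ≪≫ λ_ _

theorem mate_hom (i₁ : AdjointInverse e₁) (i₂ : AdjointInverse e₂) (n : e₁ ≫ h ≅ g ≫ e₂) :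
    (mate i₁ i₂ n).hom = Bicategory.mateEquiv i₁.adj i₂.adj n.inv := by
  simp [mate, Bicategory.mateEquiv, Adjunction.homEquiv₁, Adjunction.homEquiv₂, adj]

theorem unit_mate (i₁ : AdjointInverse e₁) (i₂ : AdjointInverse e₂) (n : e₁ ≫ h ≅ g ≫ e₂) :
    i₁.unit.hom ▷ g ≫ (α_ _ _ _).hom ≫ e₁ ◁ (mate i₁ i₂ n).hom ≫ (α_ _ _ _).inv ≫
      n.hom ▷ i₂.inv ≫ (α_ _ _ _).hom = (λ_ g).hom ≫ (ρ_ g).inv ≫ g ◁ i₂.unit.hom := by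
  have := (Bicategory.mateEquiv_eq_iff i₁.adj i₂.adj n.inv _).1 (mate_hom i₁ i₂ n).symm
  simp only [Adjunction.homEquiv₁, Adjunction.homEquiv₂, adj, Equiv.coe_fn_mk,
    Equiv.coe_fn_symm_mk, Category.assoc] at this
  rw [Iso.inv_comp_eq] at this
  rw [reassoc_of% this]
  simp

theorem mate_counit (i₁ : AdjointInverse e₁) (i₂ : AdjointInverse e₂) (n : e₁ ≫ h ≅ g ≫ e₂) :
    (α_ _ _ _).hom ≫ i₁.inv ◁ n.hom ≫ (α_ _ _ _).inv ≫ (mate i₁ i₂ n).hom ▷ e₂ ≫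
      (α_ _ _ _).hom ≫ h ◁ i₂.counit.hom = i₁.counit.hom ▷ h ≫ (λ_ h).hom ≫ (ρ_ h).inv := by
  have key : (mate i₁ i₂ n).hom ▷ e₂ ≫ (α_ _ _ _).hom ≫ h ◁ i₂.counit.hom =
      (α_ _ _ _).hom ≫ i₁.inv ◁ n.inv ≫ (α_ _ _ _).inv ≫ i₁.counit.hom ▷ h ≫ (λ_ h).hom ≫
        (ρ_ h).inv := by
    rw [mate_hom, Bicategory.mateEquiv_apply']
    calc
      _ = 𝟙 _ ⊗≫ i₁.inv ◁ g ◁ i₂.unit.hom ▷ e₂ ⊗≫ i₁.inv ◁ n.inv ▷ (i₂.inv ≫ e₂) ⊗≫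
            (i₁.counit.hom ▷ (h ≫ (i₂.inv ≫ e₂)) ≫ 𝟙 _ ◁ h ◁ i₂.counit.hom) ⊗≫ 𝟙 _ := by
          simp only [adj]; bicategory
      _ = 𝟙 _ ⊗≫ i₁.inv ◁ g ◁ i₂.unit.hom ▷ e₂ ⊗≫
            i₁.inv ◁ (n.inv ▷ (i₂.inv ≫ e₂) ≫ (e₁ ≫ h) ◁ i₂.counit.hom) ⊗≫
            i₁.counit.hom ▷ h ⊗≫ 𝟙 _ := by
          rw [← whisker_exchange]; bicategory
      _ = 𝟙 _ ⊗≫ i₁.inv ◁ g ◁ leftZigzag i₂.unit.hom i₂.counit.hom ⊗≫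
            i₁.inv ◁ n.inv ⊗≫ i₁.counit.hom ▷ h ⊗≫ 𝟙 _ := by
          rw [← whisker_exchange]; bicategory
      _ = _ := by rw [i₂.triangle]; bicategory
  rw [key]
  simp

end AdjointInverse

end Restriction

/-! ### The bicategory of fractions -/

section Fractions

variable {C : Type u} [Bicategory.{w, v} C]

/-- The objects of the bicategory of fractions `C[W⁻¹]` are those of `C`. -/
structure Fractions (W : MorphismProperty C) where
  obj : C

namespace Fractions

/-- 1-morphisms of `C[W⁻¹]`: formal composites of 1-morphisms of `C` and of formal
quasi-inverses of the elements of `W`. -/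
inductive Hom (W : MorphismProperty C) : C → C → Type max u v
  | of {a b : C} (f : a ⟶ b) : Hom W a b
  | inv {a b : C} (f : a ⟶ b) (hf : W f) : Hom W b a
  | id (a : C) : Hom W a a
  | comp {a b c : C} (f : Hom W a b) (g : Hom W b c) : Hom W a c

/-- Representatives of 2-morphisms of `C[W⁻¹]`: formal composites of 2-morphisms of `C`,
of the structural 2-morphisms of a bicategory, of the structural 2-morphisms of the pseudofunctor
`C ⥤ C[W⁻¹]`, and of the unit and counit making the elements of `W` into equivalences. -/
inductive Hom₂ (W : MorphismProperty C) : ∀ {a b : C}, Hom W a b → Hom W a b → Type max u v w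
  | id {a b} (f : Hom W a b) : Hom₂ W f f
  | vcomp {a b} {f g h : Hom W a b} (η : Hom₂ W f g) (θ : Hom₂ W g h) : Hom₂ W f h
  | whiskerLeft {a b c} (f : Hom W a b) {g h : Hom W b c} (η : Hom₂ W g h) :
      Hom₂ W (f.comp g) (f.comp h)
  | whiskerRight {a b c} {f g : Hom W a b} (h : Hom W b c) (η : Hom₂ W f g) :
      Hom₂ W (f.comp h) (g.comp h)
  | associator {a b c d} (f : Hom W a b) (g : Hom W b c) (h : Hom W c d) :
      Hom₂ W ((f.comp g).comp h) (f.comp (g.comp h))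
  | associatorInv {a b c d} (f : Hom W a b) (g : Hom W b c) (h : Hom W c d) :
      Hom₂ W (f.comp (g.comp h)) ((f.comp g).comp h)
  | rightUnitor {a b} (f : Hom W a b) : Hom₂ W (f.comp (.id b)) f
  | rightUnitorInv {a b} (f : Hom W a b) : Hom₂ W f (f.comp (.id b))
  | leftUnitor {a b} (f : Hom W a b) : Hom₂ W ((Hom.id a).comp f) f
  | leftUnitorInv {a b} (f : Hom W a b) : Hom₂ W f ((Hom.id a).comp f)
  | of {a b : C} {f g : a ⟶ b} (η : f ⟶ g) : Hom₂ W (.of f) (.of g)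
  | mapId (a : C) : Hom₂ W (.of (𝟙 a)) (.id a)
  | mapIdInv (a : C) : Hom₂ W (.id a) (.of (𝟙 a))
  | mapComp {a b c : C} (f : a ⟶ b) (g : b ⟶ c) :
      Hom₂ W (.of (f ≫ g)) ((Hom.of f).comp (.of g))
  | mapCompInv {a b c : C} (f : a ⟶ b) (g : b ⟶ c) :
      Hom₂ W ((Hom.of f).comp (.of g)) (.of (f ≫ g))
  | unit {a b : C} (f : a ⟶ b) (hf : W f) : Hom₂ W (.id a) ((Hom.of f).comp (.inv f hf))
  | unitInv {a b : C} (f : a ⟶ b) (hf : W f) : Hom₂ W ((Hom.of f).comp (.inv f hf)) (.id a)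
  | counit {a b : C} (f : a ⟶ b) (hf : W f) : Hom₂ W ((Hom.inv f hf).comp (.of f)) (.id b)
  | counitInv {a b : C} (f : a ⟶ b) (hf : W f) : Hom₂ W (.id b) ((Hom.inv f hf).comp (.of f))

/-- The relations between 2-morphisms of `C[W⁻¹]`: the axioms of a bicategory, those making
`C ⥤ C[W⁻¹]` a pseudofunctor, and those making every element of `W` the left half of an adjoint
equivalence. -/
inductive Rel (W : MorphismProperty C) :
    ∀ {a b : C} {f g : Hom W a b}, Hom₂ W f g → Hom₂ W f g → Prop
  | vcomp_right {a b} {f g h : Hom W a b} (η : Hom₂ W f g) (θ₁ θ₂ : Hom₂ W g h) :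
      Rel W θ₁ θ₂ → Rel W (η.vcomp θ₁) (η.vcomp θ₂)
  | vcomp_left {a b} {f g h : Hom W a b} (η₁ η₂ : Hom₂ W f g) (θ : Hom₂ W g h) :
      Rel W η₁ η₂ → Rel W (η₁.vcomp θ) (η₂.vcomp θ)
  | id_comp {a b} {f g : Hom W a b} (η : Hom₂ W f g) : Rel W ((Hom₂.id f).vcomp η) η
  | comp_id {a b} {f g : Hom W a b} (η : Hom₂ W f g) : Rel W (η.vcomp (.id g)) η
  | assoc {a b} {f g h i : Hom W a b} (η : Hom₂ W f g) (θ : Hom₂ W g h) (ι : Hom₂ W h i) :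
      Rel W ((η.vcomp θ).vcomp ι) (η.vcomp (θ.vcomp ι))
  | whiskerLeft {a b c} (f : Hom W a b) (g h : Hom W b c) (η η' : Hom₂ W g h) :
      Rel W η η' → Rel W (.whiskerLeft f η) (.whiskerLeft f η')
  | whiskerLeft_id {a b c} (f : Hom W a b) (g : Hom W b c) :
      Rel W (.whiskerLeft f (.id g)) (.id (f.comp g))
  | whiskerLeft_comp {a b c} (f : Hom W a b) {g h i : Hom W b c} (η : Hom₂ W g h)
      (θ : Hom₂ W h i) :
      Rel W (.whiskerLeft f (η.vcomp θ)) ((Hom₂.whiskerLeft f η).vcomp (.whiskerLeft f θ))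
  | id_whiskerLeft {a b} {f g : Hom W a b} (η : Hom₂ W f g) :
      Rel W (.whiskerLeft (.id a) η)
        ((Hom₂.leftUnitor f).vcomp (η.vcomp (.leftUnitorInv g)))
  | comp_whiskerLeft {a b c d} (f : Hom W a b) (g : Hom W b c) {h h' : Hom W c d}
      (η : Hom₂ W h h') :
      Rel W (.whiskerLeft (f.comp g) η) ((Hom₂.associator f g h).vcomp
        ((Hom₂.whiskerLeft f (.whiskerLeft g η)).vcomp (.associatorInv f g h')))
  | whiskerRight {a b c} (f g : Hom W a b) (h : Hom W b c) (η η' : Hom₂ W f g) :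
      Rel W η η' → Rel W (.whiskerRight h η) (.whiskerRight h η')
  | id_whiskerRight {a b c} (f : Hom W a b) (g : Hom W b c) :
      Rel W (.whiskerRight g (.id f)) (.id (f.comp g))
  | comp_whiskerRight {a b c} {f g h : Hom W a b} (i : Hom W b c) (η : Hom₂ W f g)
      (θ : Hom₂ W g h) :
      Rel W (.whiskerRight i (η.vcomp θ)) ((Hom₂.whiskerRight i η).vcomp (.whiskerRight i θ))
  | whiskerRight_id {a b} {f g : Hom W a b} (η : Hom₂ W f g) :
      Rel W (.whiskerRight (.id b) η)
        ((Hom₂.rightUnitor f).vcomp (η.vcomp (.rightUnitorInv g)))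
  | whiskerRight_comp {a b c d} {f f' : Hom W a b} (g : Hom W b c) (h : Hom W c d)
      (η : Hom₂ W f f') :
      Rel W (.whiskerRight (g.comp h) η) ((Hom₂.associatorInv f g h).vcomp
        ((Hom₂.whiskerRight h (.whiskerRight g η)).vcomp (.associator f' g h)))
  | whisker_assoc {a b c d} (f : Hom W a b) {g g' : Hom W b c} (η : Hom₂ W g g')
      (h : Hom W c d) :
      Rel W (.whiskerRight h (.whiskerLeft f η)) ((Hom₂.associator f g h).vcomp
        ((Hom₂.whiskerLeft f (.whiskerRight h η)).vcomp (.associatorInv f g' h)))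
  | whisker_exchange {a b c} {f g : Hom W a b} {h i : Hom W b c} (η : Hom₂ W f g)
      (θ : Hom₂ W h i) :
      Rel W ((Hom₂.whiskerLeft f θ).vcomp (.whiskerRight i η))
        ((Hom₂.whiskerRight h η).vcomp (.whiskerLeft g θ))
  | associator_hom_inv {a b c d} (f : Hom W a b) (g : Hom W b c) (h : Hom W c d) :
      Rel W ((Hom₂.associator f g h).vcomp (.associatorInv f g h)) (.id _)
  | associator_inv_hom {a b c d} (f : Hom W a b) (g : Hom W b c) (h : Hom W c d) :
      Rel W ((Hom₂.associatorInv f g h).vcomp (.associator f g h)) (.id _)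
  | leftUnitor_hom_inv {a b} (f : Hom W a b) :
      Rel W ((Hom₂.leftUnitor f).vcomp (.leftUnitorInv f)) (.id _)
  | leftUnitor_inv_hom {a b} (f : Hom W a b) :
      Rel W ((Hom₂.leftUnitorInv f).vcomp (.leftUnitor f)) (.id _)
  | rightUnitor_hom_inv {a b} (f : Hom W a b) :
      Rel W ((Hom₂.rightUnitor f).vcomp (.rightUnitorInv f)) (.id _)
  | rightUnitor_inv_hom {a b} (f : Hom W a b) :
      Rel W ((Hom₂.rightUnitorInv f).vcomp (.rightUnitor f)) (.id _)
  | pentagon {a b c d e} (f : Hom W a b) (g : Hom W b c) (h : Hom W c d) (i : Hom W d e) :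
      Rel W ((Hom₂.whiskerRight i (.associator f g h)).vcomp
          ((Hom₂.associator f (g.comp h) i).vcomp (.whiskerLeft f (.associator g h i))))
        ((Hom₂.associator (f.comp g) h i).vcomp (.associator f g (h.comp i)))
  | triangle {a b c} (f : Hom W a b) (g : Hom W b c) :
      Rel W ((Hom₂.associator f (.id b) g).vcomp (.whiskerLeft f (.leftUnitor g)))
        (.whiskerRight g (.rightUnitor f))
  | of_id {a b : C} (f : a ⟶ b) : Rel W (.of (𝟙 f)) (.id (.of f))
  | of_comp {a b : C} {f g h : a ⟶ b} (η : f ⟶ g) (θ : g ⟶ h) :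
      Rel W (.of (η ≫ θ)) ((Hom₂.of η).vcomp (.of θ))
  | mapId_hom_inv (a : C) : Rel W ((Hom₂.mapId a).vcomp (.mapIdInv a)) (.id _)
  | mapId_inv_hom (a : C) : Rel W ((Hom₂.mapIdInv a).vcomp (.mapId a)) (.id _)
  | mapComp_hom_inv {a b c : C} (f : a ⟶ b) (g : b ⟶ c) :
      Rel W ((Hom₂.mapComp f g).vcomp (.mapCompInv f g)) (.id _)
  | mapComp_inv_hom {a b c : C} (f : a ⟶ b) (g : b ⟶ c) :
      Rel W ((Hom₂.mapCompInv f g).vcomp (.mapComp f g)) (.id _)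
  | of_whiskerLeft {a b c : C} (f : a ⟶ b) {g h : b ⟶ c} (η : g ⟶ h) :
      Rel W (.of (f ◁ η)) ((Hom₂.mapComp f g).vcomp
        ((Hom₂.whiskerLeft (.of f) (.of η)).vcomp (.mapCompInv f h)))
  | of_whiskerRight {a b c : C} {f g : a ⟶ b} (η : f ⟶ g) (h : b ⟶ c) :
      Rel W (.of (η ▷ h)) ((Hom₂.mapComp f h).vcomp
        ((Hom₂.whiskerRight (.of h) (.of η)).vcomp (.mapCompInv g h)))
  | of_associator {a b c d : C} (f : a ⟶ b) (g : b ⟶ c) (h : c ⟶ d) :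
      Rel W (.of (α_ f g h).hom) ((Hom₂.mapComp (f ≫ g) h).vcomp
        ((Hom₂.whiskerRight (.of h) (.mapComp f g)).vcomp
          ((Hom₂.associator (.of f) (.of g) (.of h)).vcomp
            ((Hom₂.whiskerLeft (.of f) (.mapCompInv g h)).vcomp (.mapCompInv f (g ≫ h))))))
  | of_leftUnitor {a b : C} (f : a ⟶ b) :
      Rel W (.of (λ_ f).hom) ((Hom₂.mapComp (𝟙 a) f).vcomp
        ((Hom₂.whiskerRight (.of f) (.mapId a)).vcomp (.leftUnitor (.of f))))
  | of_rightUnitor {a b : C} (f : a ⟶ b) :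
      Rel W (.of (ρ_ f).hom) ((Hom₂.mapComp f (𝟙 b)).vcomp
        ((Hom₂.whiskerLeft (.of f) (.mapId b)).vcomp (.rightUnitor (.of f))))
  | unit_hom_inv {a b : C} (f : a ⟶ b) (hf : W f) :
      Rel W ((Hom₂.unit f hf).vcomp (.unitInv f hf)) (.id _)
  | unit_inv_hom {a b : C} (f : a ⟶ b) (hf : W f) :
      Rel W ((Hom₂.unitInv f hf).vcomp (.unit f hf)) (.id _)
  | counit_hom_inv {a b : C} (f : a ⟶ b) (hf : W f) :
      Rel W ((Hom₂.counit f hf).vcomp (.counitInv f hf)) (.id _)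
  | counit_inv_hom {a b : C} (f : a ⟶ b) (hf : W f) :
      Rel W ((Hom₂.counitInv f hf).vcomp (.counit f hf)) (.id _)
  | zigzag {a b : C} (f : a ⟶ b) (hf : W f) :
      Rel W ((Hom₂.whiskerRight (.of f) (.unit f hf)).vcomp
          ((Hom₂.associator (.of f) (.inv f hf) (.of f)).vcomp
            (.whiskerLeft (.of f) (.counit f hf))))
        ((Hom₂.leftUnitor (.of f)).vcomp (.rightUnitorInv (.of f)))

variable (W : MorphismProperty C)

instance : CategoryStruct (Fractions W) where
  Hom a b := Hom W a.obj b.obj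
  id a := Hom.id a.obj
  comp := Hom.comp

instance homCategory (a b : Fractions W) : Category (a ⟶ b) where
  Hom f g := Quot (@Rel _ _ W a.obj b.obj f g)
  id f := Quot.mk _ (Hom₂.id f)
  comp := @fun _ _ _ => Quot.map₂ Hom₂.vcomp Rel.vcomp_right Rel.vcomp_left
  id_comp := by
    rintro f g ⟨η⟩
    exact Quot.sound (Rel.id_comp η)
  comp_id := by
    rintro f g ⟨η⟩
    exact Quot.sound (Rel.comp_id η)
  assoc := by
    rintro f g h i ⟨η⟩ ⟨θ⟩ ⟨ι⟩
    exact Quot.sound (Rel.assoc η θ ι)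

/-- The bicategory of fractions `C[W⁻¹]`, obtained from `C` by freely adjoining a quasi-inverse
to each element of `W`. It is characterised, up to equivalence of bicategories, by the universal
property `Fractions.exists_extension`, `Fractions.isEquivalence_restriction` below. -/
instance bicategory : Bicategory (Fractions W) where
  homCategory := homCategory W
  whiskerLeft := @fun _ _ _ f g h η => Quot.map (Hom₂.whiskerLeft f) (Rel.whiskerLeft f g h) η
  whiskerRight := @fun _ _ _ f g η h => Quot.map (Hom₂.whiskerRight h) (Rel.whiskerRight f g h) η
  associator := @fun _ _ _ _ f g h =>
    { hom := Quot.mk _ (Hom₂.associator f g h)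
      inv := Quot.mk _ (Hom₂.associatorInv f g h)
      hom_inv_id := Quot.sound (Rel.associator_hom_inv f g h)
      inv_hom_id := Quot.sound (Rel.associator_inv_hom f g h) }
  leftUnitor := @fun _ _ f =>
    { hom := Quot.mk _ (Hom₂.leftUnitor f)
      inv := Quot.mk _ (Hom₂.leftUnitorInv f)
      hom_inv_id := Quot.sound (Rel.leftUnitor_hom_inv f)
      inv_hom_id := Quot.sound (Rel.leftUnitor_inv_hom f) }
  rightUnitor := @fun _ _ f =>
    { hom := Quot.mk _ (Hom₂.rightUnitor f)
      inv := Quot.mk _ (Hom₂.rightUnitorInv f)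
      hom_inv_id := Quot.sound (Rel.rightUnitor_hom_inv f)
      inv_hom_id := Quot.sound (Rel.rightUnitor_inv_hom f) }
  whiskerLeft_id := @fun _ _ _ f g => Quot.sound (Rel.whiskerLeft_id f g)
  whiskerLeft_comp := by
    rintro a b c f g h i ⟨η⟩ ⟨θ⟩
    exact Quot.sound (Rel.whiskerLeft_comp f η θ)
  id_whiskerLeft := by
    rintro a b f g ⟨η⟩
    exact Quot.sound (Rel.id_whiskerLeft η)
  comp_whiskerLeft := by
    rintro a b c d f g h h' ⟨η⟩
    exact Quot.sound (Rel.comp_whiskerLeft f g η)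
  id_whiskerRight := @fun _ _ _ f g => Quot.sound (Rel.id_whiskerRight f g)
  comp_whiskerRight := by
    rintro a b c f g h ⟨η⟩ ⟨θ⟩ i
    exact Quot.sound (Rel.comp_whiskerRight i η θ)
  whiskerRight_id := by
    rintro a b f g ⟨η⟩
    exact Quot.sound (Rel.whiskerRight_id η)
  whiskerRight_comp := by
    rintro a b c d f f' ⟨η⟩ g h
    exact Quot.sound (Rel.whiskerRight_comp g h η)
  whisker_assoc := by
    rintro a b c d f g g' ⟨η⟩ h
    exact Quot.sound (Rel.whisker_assoc f η h)
  whisker_exchange := by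
    rintro a b c f g h i ⟨η⟩ ⟨θ⟩
    exact Quot.sound (Rel.whisker_exchange η θ)
  pentagon := @fun _ _ _ _ _ f g h i => Quot.sound (Rel.pentagon f g h i)
  triangle := @fun _ _ _ f g => Quot.sound (Rel.triangle f g)

/-- The canonical pseudofunctor `U_W : C ⥤ C[W⁻¹]`. -/
def localize : C ⥤ᵖ Fractions W where
  obj a := ⟨a⟩
  map f := Hom.of f
  map₂ η := Quot.mk _ (Hom₂.of η)
  map₂_id f := Quot.sound (Rel.of_id f)
  map₂_comp η θ := Quot.sound (Rel.of_comp η θ)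
  mapId a :=
    { hom := Quot.mk _ (Hom₂.mapId a)
      inv := Quot.mk _ (Hom₂.mapIdInv a)
      hom_inv_id := Quot.sound (Rel.mapId_hom_inv a)
      inv_hom_id := Quot.sound (Rel.mapId_inv_hom a) }
  mapComp f g :=
    { hom := Quot.mk _ (Hom₂.mapComp f g)
      inv := Quot.mk _ (Hom₂.mapCompInv f g)
      hom_inv_id := Quot.sound (Rel.mapComp_hom_inv f g)
      inv_hom_id := Quot.sound (Rel.mapComp_inv_hom f g) }
  map₂_whisker_left f _ _ η := Quot.sound (Rel.of_whiskerLeft f η)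
  map₂_whisker_right η h := Quot.sound (Rel.of_whiskerRight η h)
  map₂_associator f g h := Quot.sound (Rel.of_associator f g h)
  map₂_left_unitor f := Quot.sound (Rel.of_leftUnitor f)
  map₂_right_unitor f := Quot.sound (Rel.of_rightUnitor f)

/-- The formal quasi-inverse of an element of `W` is an adjoint quasi-inverse of its image. -/
def localizeInverse {a b : C} (f : a ⟶ b) (hf : W f) : AdjointInverse ((localize W).map f) where
  inv := Hom.inv f hf
  unit :=
    { hom := Quot.mk _ (Hom₂.unit f hf)
      inv := Quot.mk _ (Hom₂.unitInv f hf)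
      hom_inv_id := Quot.sound (Rel.unit_hom_inv f hf)
      inv_hom_id := Quot.sound (Rel.unit_inv_hom f hf) }
  counit :=
    { hom := Quot.mk _ (Hom₂.counit f hf)
      inv := Quot.mk _ (Hom₂.counitInv f hf)
      hom_inv_id := Quot.sound (Rel.counit_hom_inv f hf)
      inv_hom_id := Quot.sound (Rel.counit_inv_hom f hf) }
  triangle := by
    simp only [leftZigzag, bicategoricalComp]
    simp
    exact Quot.sound (Rel.zigzag f hf)

/-- `U_W` sends each element of `W` to an internal equivalence. -/
theorem isInternalEquivalence_localize {a b : C} (f : a ⟶ b) (hf : W f) :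
    IsInternalEquivalence ((localize W).map f) :=
  (localizeInverse W f hf).isInternalEquivalence

section Lift

variable {W}
variable {D : Type u₁} [Bicategory.{w₁, v₁} D] (F : C ⥤ᵖ D)
  (q : ∀ ⦃a b : C⦄ (f : a ⟶ b), W f → AdjointInverse (F.map f))

/-- Auxiliary definition for `lift`. -/
def liftHom : ∀ {a b : C}, Hom W a b → (F.obj a ⟶ F.obj b)
  | _, _, .of f => F.map f
  | _, _, .inv f hf => (q f hf).inv
  | _, _, .id a => 𝟙 (F.obj a)
  | _, _, .comp f g => liftHom f ≫ liftHom g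

/-- Auxiliary definition for `lift`. -/
def liftHom₂ : ∀ {a b : C} {f g : Hom W a b}, Hom₂ W f g → (liftHom F q f ⟶ liftHom F q g)
  | _, _, _, _, .id _ => 𝟙 _
  | _, _, _, _, .vcomp η θ => liftHom₂ η ≫ liftHom₂ θ
  | _, _, _, _, .whiskerLeft f η => liftHom F q f ◁ liftHom₂ η
  | _, _, _, _, .whiskerRight h η => liftHom₂ η ▷ liftHom F q h
  | _, _, _, _, .associator _ _ _ => (α_ _ _ _).hom
  | _, _, _, _, .associatorInv _ _ _ => (α_ _ _ _).inv
  | _, _, _, _, .rightUnitor _ => (ρ_ _).hom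
  | _, _, _, _, .rightUnitorInv _ => (ρ_ _).inv
  | _, _, _, _, .leftUnitor _ => (λ_ _).hom
  | _, _, _, _, .leftUnitorInv _ => (λ_ _).inv
  | _, _, _, _, .of η => F.map₂ η
  | _, _, _, _, .mapId a => (F.mapId a).hom
  | _, _, _, _, .mapIdInv a => (F.mapId a).inv
  | _, _, _, _, .mapComp f g => (F.mapComp f g).hom
  | _, _, _, _, .mapCompInv f g => (F.mapComp f g).inv
  | _, _, _, _, .unit f hf => (q f hf).unit.hom
  | _, _, _, _, .unitInv f hf => (q f hf).unit.inv
  | _, _, _, _, .counit f hf => (q f hf).counit.hom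
  | _, _, _, _, .counitInv f hf => (q f hf).counit.inv

theorem liftHom₂_congr {a b : C} {f g : Hom W a b} {η θ : Hom₂ W f g} (H : Rel W η θ) :
    liftHom₂ F q η = liftHom₂ F q θ := by
  induction H with
  | zigzag f hf =>
    have := (q f hf).triangle
    simp only [leftZigzag, bicategoricalComp] at this
    simpa [liftHom₂, liftHom] using this
  | whisker_exchange => simp [liftHom₂, liftHom, whisker_exchange]
  | vcomp_right _ _ _ _ ih => simp [liftHom₂, ih]
  | vcomp_left _ _ _ _ ih => simp [liftHom₂, ih]
  | whiskerLeft f _ _ _ _ _ ih => exact congrArg (liftHom F q f ◁ ·) ih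
  | whiskerRight _ _ h _ _ _ ih => exact congrArg (· ▷ liftHom F q h) ih
  | _ => simp [liftHom₂, liftHom]

/-- A pseudofunctor `F : C ⥤ D`, together with adjoint quasi-inverses of the images of the
elements of `W`, extends to `C[W⁻¹]`. -/
def lift : Fractions W ⥤ᵖ D where
  obj a := F.obj a.obj
  map f := liftHom F q f
  map₂ := Quot.lift (liftHom₂ F q) fun _ _ H => liftHom₂_congr F q H
  map₂_id _ := rfl
  map₂_comp := by rintro _ _ _ _ _ ⟨η⟩ ⟨θ⟩; rfl
  mapId _ := Iso.refl _
  mapComp _ _ := Iso.refl _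
  map₂_whisker_left := by
    rintro _ _ _ f _ _ ⟨η⟩
    exact (by simp : liftHom F q f ◁ liftHom₂ F q η =
      𝟙 _ ≫ liftHom F q f ◁ liftHom₂ F q η ≫ 𝟙 _)
  map₂_whisker_right := by
    rintro _ _ _ _ _ ⟨η⟩ h
    exact (by simp : liftHom₂ F q η ▷ liftHom F q h =
      𝟙 _ ≫ liftHom₂ F q η ▷ liftHom F q h ≫ 𝟙 _)
  map₂_associator := by
    intro _ _ _ _ f g h
    exact (by simp : (α_ (liftHom F q f) (liftHom F q g) (liftHom F q h)).hom =
      𝟙 _ ≫ 𝟙 _ ▷ _ ≫ (α_ _ _ _).hom ≫ _ ◁ 𝟙 _ ≫ 𝟙 _)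
  map₂_left_unitor := by
    intro _ _ f
    exact (by simp : (λ_ (liftHom F q f)).hom = 𝟙 _ ≫ 𝟙 _ ▷ _ ≫ (λ_ _).hom)
  map₂_right_unitor := by
    intro _ _ f
    exact (by simp : (ρ_ (liftHom F q f)).hom = 𝟙 _ ≫ _ ◁ 𝟙 _ ≫ (ρ_ _).hom)

/-- The comparison from `F` to the restriction of `lift F q` along `U_W`. -/
def liftTrans : F ⟶ (localize W).comp (lift F q) where
  app a := 𝟙 (F.obj a)
  naturality f := (ρ_ (F.map f)) ≪≫ (λ_ (F.map f)).symm
  naturality_naturality η := (by simp : F.map₂ η ▷ 𝟙 _ ≫ (ρ_ _).hom ≫ (λ_ _).inv =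
    ((ρ_ _).hom ≫ (λ_ _).inv) ≫ 𝟙 _ ◁ F.map₂ η)
  naturality_id a := (by simp : ((ρ_ _).hom ≫ (λ_ _).inv) ≫ 𝟙 _ ◁ ((F.mapId a).hom ≫ 𝟙 _) =
    (F.mapId a).hom ▷ 𝟙 _ ≫ (λ_ _).hom ≫ (ρ_ _).inv)
  naturality_comp f g := (by simp :
    ((ρ_ _).hom ≫ (λ_ _).inv) ≫ 𝟙 _ ◁ ((F.mapComp f g).hom ≫ 𝟙 _) =
      (F.mapComp f g).hom ▷ 𝟙 _ ≫ (α_ _ _ _).hom ≫ F.map f ◁ ((ρ_ _).hom ≫ (λ_ _).inv) ≫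
        (α_ _ _ _).inv ≫ ((ρ_ _).hom ≫ (λ_ _).inv) ▷ F.map g ≫ (α_ _ _ _).hom)

/-- The comparison from the restriction of `lift F q` along `U_W` to `F`. -/
def liftTransInv : (localize W).comp (lift F q) ⟶ F where
  app a := 𝟙 (F.obj a)
  naturality f := (ρ_ (F.map f)) ≪≫ (λ_ (F.map f)).symm
  naturality_naturality η := (by simp : F.map₂ η ▷ 𝟙 _ ≫ (ρ_ _).hom ≫ (λ_ _).inv =
    ((ρ_ _).hom ≫ (λ_ _).inv) ≫ 𝟙 _ ◁ F.map₂ η)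
  naturality_id a := (by simp : ((ρ_ _).hom ≫ (λ_ _).inv) ≫ 𝟙 _ ◁ (F.mapId a).hom =
    ((F.mapId a).hom ≫ 𝟙 _) ▷ 𝟙 _ ≫ (λ_ _).hom ≫ (ρ_ _).inv)
  naturality_comp f g := (by simp :
    ((ρ_ _).hom ≫ (λ_ _).inv) ≫ 𝟙 _ ◁ (F.mapComp f g).hom =
      ((F.mapComp f g).hom ≫ 𝟙 _) ▷ 𝟙 _ ≫ (α_ _ _ _).hom ≫ F.map f ◁ ((ρ_ _).hom ≫ (λ_ _).inv) ≫
        (α_ _ _ _).inv ≫ ((ρ_ _).hom ≫ (λ_ _).inv) ▷ F.map g ≫ (α_ _ _ _).hom)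

theorem isInternalEquivalence_liftTrans : IsInternalEquivalence (liftTrans F q) := by
  refine ⟨liftTransInv F q, ⟨Pseudofunctor.StrongTrans.isoMk (fun a => (λ_ (𝟙 (F.obj a))).symm) ?_⟩,
    ⟨Pseudofunctor.StrongTrans.isoMk (fun a => λ_ (𝟙 (F.obj a))) ?_⟩⟩
  · intro a b f
    exact (by bicategory : F.map f ◁ (λ_ (𝟙 (F.obj b))).inv ≫ (α_ _ _ _).inv ≫
      ((ρ_ (F.map f)).hom ≫ (λ_ (F.map f)).inv) ▷ 𝟙 _ ≫ (α_ _ _ _).hom ≫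
      𝟙 _ ◁ ((ρ_ (F.map f)).hom ≫ (λ_ (F.map f)).inv) ≫ (α_ _ _ _).inv =
      ((ρ_ (F.map f)).hom ≫ (λ_ (F.map f)).inv) ≫ (λ_ (𝟙 (F.obj a))).inv ▷ F.map f)
  · intro a b f
    exact (by bicategory : F.map f ◁ (λ_ (𝟙 (F.obj b))).hom ≫ (ρ_ (F.map f)).hom ≫
      (λ_ (F.map f)).inv =
      ((α_ _ _ _).inv ≫ ((ρ_ (F.map f)).hom ≫ (λ_ (F.map f)).inv) ▷ 𝟙 _ ≫ (α_ _ _ _).hom ≫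
      𝟙 _ ◁ ((ρ_ (F.map f)).hom ≫ (λ_ (F.map f)).inv) ≫ (α_ _ _ _).inv) ≫
      (λ_ (𝟙 (F.obj a))).hom ▷ F.map f)

/-- Every pseudofunctor sending the elements of `W` to internal equivalences extends along `U_W`,
up to a pseudonatural equivalence. -/
theorem exists_extension (F : C ⥤ᵖ D)
    (hF : ∀ ⦃a b : C⦄ (f : a ⟶ b), W f → IsInternalEquivalence (F.map f)) :
    ∃ (G : Fractions W ⥤ᵖ D) (κ : F ⟶ (localize W).comp G), IsInternalEquivalence κ :=
  ⟨lift F fun _ _ f hf => (AdjointInverse.nonempty (hF f hf)).some, _,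
    isInternalEquivalence_liftTrans F _⟩

end Lift
/-! ### The universal property of `U_W` on pseudonatural transformations -/

namespace ExtendTrans

variable {L : Type u₁} [Bicategory.{w₁, v₁} L] {D : Type u₂} [Bicategory.{w₂, v₂} D]
  {G G' : L ⥤ᵖ D} (app : ∀ a : L, G.obj a ⟶ G'.obj a)

/-- Auxiliary definition for `extendTrans`. -/
abbrev Square {a b : L} (f : a ⟶ b) := G.map f ≫ app b ≅ app a ≫ G'.map f

/-- Auxiliary definition for `extendTrans`. -/
def cyl (a : L) : Cyl D := ⟨G.obj a, G'.obj a, app a⟩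

/-- Auxiliary definition for `extendTrans`. -/
def cylHom {a b : L} {f : a ⟶ b} (n : Square app f) : cyl app a ⟶ cyl app b :=
  Cyl.Hom.mk (G.map f) (G'.map f) n.hom

@[simp] lemma cylHom_fst {a b : L} {f : a ⟶ b} (n : Square app f) :
    Cyl.Hom.fst (cylHom app n) = G.map f := rfl
@[simp] lemma cylHom_snd {a b : L} {f : a ⟶ b} (n : Square app f) :
    Cyl.Hom.snd (cylHom app n) = G'.map f := rfl

/-- Auxiliary definition for `extendTrans`. -/
def IsNat {a b : L} {f g : a ⟶ b} (n : Square app f) (m : Square app g) (η : f ⟶ g) : Prop :=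
  ∃ H : cylHom app n ⟶ cylHom app m, Cyl.Hom₂.fst H = G.map₂ η ∧ Cyl.Hom₂.snd H = G'.map₂ η

/-- Auxiliary definition for `extendTrans`. -/
def idSquare (a : L) : Square app (𝟙 a) :=
  whiskerRightIso (G.mapId a) _ ≪≫ λ_ _ ≪≫ (ρ_ _).symm ≪≫ whiskerLeftIso _ (G'.mapId a).symm

/-- Auxiliary definition for `extendTrans`. -/
def compSquare {a b c : L} {f : a ⟶ b} {g : b ⟶ c} (n : Square app f) (m : Square app g) :
    Square app (f ≫ g) :=
  whiskerRightIso (G.mapComp f g) _ ≪≫ α_ _ _ _ ≪≫ whiskerLeftIso _ m ≪≫ (α_ _ _ _).symm ≪≫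
    whiskerRightIso n _ ≪≫ α_ _ _ _ ≪≫ whiskerLeftIso _ (G'.mapComp f g).symm

/-- Auxiliary definition for `extendTrans`. -/
def invSquare {a b : L} {e : a ⟶ b} (i : AdjointInverse e) (n : Square app e) :
    Square app i.inv :=
  AdjointInverse.mate (i.map G) (i.map G') n

/-- Auxiliary definition for `extendTrans`. -/
def cylId (a : L) : cylHom app (idSquare app a) ≅ 𝟙 (cyl app a) :=
  Cyl.mkIso (f := cylHom app (idSquare app a)) (g := 𝟙 (cyl app a)) (G.mapId a) (G'.mapId a)
    (by simp [idSquare] : (G.mapId a).hom ▷ app a ≫ (λ_ (app a)).hom ≫ (ρ_ (app a)).inv =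
      (idSquare app a).hom ≫ app a ◁ (G'.mapId a).hom)

/-- Auxiliary definition for `extendTrans`. -/
def cylComp {a b c : L} {f : a ⟶ b} {g : b ⟶ c} (n : Square app f) (m : Square app g) :
    cylHom app (compSquare app n m) ≅ cylHom app n ≫ cylHom app m :=
  Cyl.mkIso (f := cylHom app (compSquare app n m)) (g := cylHom app n ≫ cylHom app m)
    (G.mapComp f g) (G'.mapComp f g) (by simp [compSquare] :
      (G.mapComp f g).hom ▷ app c ≫ (α_ _ _ _).hom ≫ G.map f ◁ m.hom ≫ (α_ _ _ _).inv ≫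
        n.hom ▷ G'.map g ≫ (α_ _ _ _).hom =
          (compSquare app n m).hom ≫ app a ◁ (G'.mapComp f g).hom)

variable {app}

theorem isNat_iff {a b : L} {f g : a ⟶ b} {n : Square app f} {m : Square app g} {η : f ⟶ g} :
    IsNat app n m η ↔ G.map₂ η ▷ app b ≫ m.hom = n.hom ≫ app a ◁ G'.map₂ η := by
  constructor
  · rintro ⟨H, h₁, h₂⟩
    have := Cyl.Hom₂.comm H
    rw [h₁, h₂] at this
    exact this
  · intro h
    exact ⟨Cyl.Hom₂.mk (f := cylHom app n) (g := cylHom app m) (G.map₂ η) (G'.map₂ η) h, rfl, rfl⟩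

theorem isNat_id {a b : L} {f : a ⟶ b} (n : Square app f) : IsNat app n n (𝟙 f) :=
  ⟨𝟙 _, (G.map₂_id f).symm, (G'.map₂_id f).symm⟩

theorem isNat_comp {a b : L} {f g h : a ⟶ b} {n : Square app f} {m : Square app g}
    {k : Square app h} {η : f ⟶ g} {θ : g ⟶ h} (h₁ : IsNat app n m η) (h₂ : IsNat app m k θ) :
    IsNat app n k (η ≫ θ) := by
  obtain ⟨H₁, h₁, h₁'⟩ := h₁
  obtain ⟨H₂, h₂, h₂'⟩ := h₂
  exact ⟨H₁ ≫ H₂, by rw [G.map₂_comp, ← h₁, ← h₂]; rfl, by rw [G'.map₂_comp, ← h₁', ← h₂']; rfl⟩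

theorem isNat_inv {a b : L} {f g : a ⟶ b} {n : Square app f} {m : Square app g}
    (η : f ≅ g) (h : IsNat app n m η.hom) : IsNat app m n η.inv := by
  rw [isNat_iff] at *
  have : (G.map₂Iso η).hom ▷ app b ≫ m.hom = n.hom ≫ app a ◁ (G'.map₂Iso η).hom := h
  change (G.map₂Iso η).inv ▷ app b ≫ n.hom = m.hom ≫ app a ◁ (G'.map₂Iso η).inv
  rw [← cancel_epi ((G.map₂Iso η).hom ▷ app b), reassoc_of% this, ← whiskerLeft_comp,
    ← comp_whiskerRight_assoc, Iso.hom_inv_id, Iso.hom_inv_id]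
  simp

theorem isNat_whiskerLeft {a b c : L} {f : a ⟶ b} {g h : b ⟶ c} (n : Square app f)
    {m : Square app g} {k : Square app h} {η : g ⟶ h} (H : IsNat app m k η) :
    IsNat app (compSquare app n m) (compSquare app n k) (f ◁ η) := by
  obtain ⟨H, h₁, h₂⟩ := H
  refine ⟨(cylComp app n m).hom ≫ cylHom app n ◁ H ≫ (cylComp app n k).inv, ?_, ?_⟩
  · rw [G.map₂_whisker_left, ← h₁]; rfl
  · rw [G'.map₂_whisker_left, ← h₂]; rfl

theorem isNat_whiskerRight {a b c : L} {f g : a ⟶ b} {h : b ⟶ c} {n : Square app f}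
    {m : Square app g} (k : Square app h) {η : f ⟶ g} (H : IsNat app n m η) :
    IsNat app (compSquare app n k) (compSquare app m k) (η ▷ h) := by
  obtain ⟨H, h₁, h₂⟩ := H
  refine ⟨(cylComp app n k).hom ≫ H ▷ cylHom app k ≫ (cylComp app m k).inv, ?_, ?_⟩
  · rw [G.map₂_whisker_right, ← h₁]; rfl
  · rw [G'.map₂_whisker_right, ← h₂]; rfl

theorem isNat_associator {a b c d : L} {f : a ⟶ b} {g : b ⟶ c} {h : c ⟶ d} (n : Square app f)
    (m : Square app g) (k : Square app h) :
    IsNat app (compSquare app (compSquare app n m) k) (compSquare app n (compSquare app m k))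
      (α_ f g h).hom :=
  ⟨(cylComp app _ k).hom ≫ (cylComp app n m).hom ▷ cylHom app k ≫ (α_ _ _ _).hom ≫
      cylHom app n ◁ (cylComp app m k).inv ≫ (cylComp app n _).inv,
    by rw [G.map₂_associator]; rfl, by rw [G'.map₂_associator]; rfl⟩

theorem isNat_leftUnitor {a b : L} {f : a ⟶ b} (n : Square app f) :
    IsNat app (compSquare app (idSquare app a) n) n (λ_ f).hom :=
  ⟨(cylComp app _ n).hom ≫ (cylId app a).hom ▷ cylHom app n ≫ (λ_ _).hom,
    by rw [G.map₂_left_unitor]; rfl, by rw [G'.map₂_left_unitor]; rfl⟩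

theorem isNat_rightUnitor {a b : L} {f : a ⟶ b} (n : Square app f) :
    IsNat app (compSquare app n (idSquare app b)) n (ρ_ f).hom :=
  ⟨(cylComp app n _).hom ≫ cylHom app n ◁ (cylId app b).hom ≫ (ρ_ _).hom,
    by rw [G.map₂_right_unitor]; rfl, by rw [G'.map₂_right_unitor]; rfl⟩

theorem isNat_unit {a b : L} {e : a ⟶ b} (i : AdjointInverse e) (n : Square app e) :
    IsNat app (idSquare app a) (compSquare app n (invSquare app i n)) i.unit.hom := by
  have h := AdjointInverse.unit_mate (i.map G) (i.map G') n
  let H : 𝟙 (cyl app a) ⟶ cylHom app n ≫ cylHom app (invSquare app i n) :=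
    Cyl.Hom₂.mk (f := 𝟙 (cyl app a)) (g := cylHom app n ≫ cylHom app (invSquare app i n))
      (i.map G).unit.hom (i.map G').unit.hom (h.trans (Category.assoc _ _ _).symm)
  exact ⟨(cylId app a).hom ≫ H ≫ (cylComp app _ _).inv,
    (by simp [AdjointInverse.map] : (G.mapId a).hom ≫ (i.map G).unit.hom ≫ (G.mapComp _ _).inv = _),
    (by simp [AdjointInverse.map] :
      (G'.mapId a).hom ≫ (i.map G').unit.hom ≫ (G'.mapComp _ _).inv = _)⟩

theorem isNat_counit {a b : L} {e : a ⟶ b} (i : AdjointInverse e) (n : Square app e) :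
    IsNat app (compSquare app (invSquare app i n) n) (idSquare app b) i.counit.hom := by
  have h' : (i.map G).counit.hom ▷ app b ≫ (λ_ (app b)).hom ≫ (ρ_ (app b)).inv =
      ((α_ _ _ _).hom ≫ (i.map G).inv ◁ n.hom ≫ (α_ _ _ _).inv ≫
        ((i.map G).mate (i.map G') n).hom ▷ G'.map e ≫ (α_ _ _ _).hom) ≫
          app b ◁ (i.map G').counit.hom := by
    rw [← AdjointInverse.mate_counit (i.map G) (i.map G') n]
    simp only [Category.assoc]
  let H : cylHom app (invSquare app i n) ≫ cylHom app n ⟶ 𝟙 (cyl app b) :=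
    Cyl.Hom₂.mk (f := cylHom app (invSquare app i n) ≫ cylHom app n) (g := 𝟙 (cyl app b))
      (i.map G).counit.hom (i.map G').counit.hom h'
  exact ⟨(cylComp app _ _).hom ≫ H ≫ (cylId app b).inv,
    (by simp [AdjointInverse.map] :
      (G.mapComp _ _).hom ≫ (i.map G).counit.hom ≫ (G.mapId _).inv = _),
    (by simp [AdjointInverse.map] :
      (G'.mapComp _ _).hom ≫ (i.map G').counit.hom ≫ (G'.mapId _).inv = _)⟩

theorem isNat_idSquare {a : L} {f : a ⟶ a} {n : Square app f} {η : f ⟶ 𝟙 a}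
    (h : n.hom ≫ app a ◁ (G'.map₂ η ≫ (G'.mapId a).hom) =
      (G.map₂ η ≫ (G.mapId a).hom) ▷ app a ≫ (λ_ (app a)).hom ≫ (ρ_ (app a)).inv) :
    IsNat app n (idSquare app a) η := by
  rw [isNat_iff, ← cancel_mono (app a ◁ (G'.mapId a).hom), Category.assoc, Category.assoc,
    ← whiskerLeft_comp, h]
  simp [idSquare]

theorem isNat_compSquare {a b c : L} {f : a ⟶ b} {g : b ⟶ c} {k : a ⟶ c} {n : Square app f}
    {m : Square app g} {l : Square app k} {η : k ⟶ f ≫ g}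
    (h : l.hom ≫ app a ◁ (G'.map₂ η ≫ (G'.mapComp f g).hom) =
      (G.map₂ η ≫ (G.mapComp f g).hom) ▷ app c ≫ (α_ _ _ _).hom ≫ G.map f ◁ m.hom ≫
        (α_ _ _ _).inv ≫ n.hom ▷ G'.map g ≫ (α_ _ _ _).hom) :
    IsNat app l (compSquare app n m) η := by
  rw [isNat_iff, ← cancel_mono (app a ◁ (G'.mapComp f g).hom), Category.assoc, Category.assoc,
    ← whiskerLeft_comp, h]
  simp [compSquare]

end ExtendTrans

section Restriction

/-- A formal composite, seen as a 1-morphism of `C[W⁻¹]`. -/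
def Hom.toHom {W : MorphismProperty C} {a b : C} (f : Hom W a b) :
    (⟨a⟩ : Fractions W) ⟶ ⟨b⟩ := f

variable {W}
variable {D : Type u₁} [Bicategory.{w₁, v₁} D] {G G' : Fractions W ⥤ᵖ D}

theorem modification_naturality {σ τ : G ⟶ G'}
    (Γ : ∀ a : C, σ.app ⟨a⟩ ⟶ τ.app ⟨a⟩)
    (hΓ : ∀ {a b : C} (f : a ⟶ b), G.map ((localize W).map f) ◁ Γ b ≫
      (τ.naturality ((localize W).map f)).hom =
        (σ.naturality ((localize W).map f)).hom ≫ Γ a ▷ G'.map ((localize W).map f)) :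
    ∀ {a b : C} (f : (⟨a⟩ : Fractions W) ⟶ ⟨b⟩),
      G.map f ◁ Γ b ≫ (τ.naturality f).hom = (σ.naturality f).hom ≫ Γ a ▷ G'.map f := by
  have hiso : ∀ {a b : C} {f g : (⟨a⟩ : Fractions W) ⟶ ⟨b⟩} (_ : f ≅ g),
      G.map f ◁ Γ b ≫ (τ.naturality f).hom = (σ.naturality f).hom ≫ Γ a ▷ G'.map f →
      G.map g ◁ Γ b ≫ (τ.naturality g).hom = (σ.naturality g).hom ≫ Γ a ▷ G'.map g := by
    intro a b f g η h
    rw [Pseudofunctor.StrongTrans.naturality_naturality_hom τ η,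
      Pseudofunctor.StrongTrans.naturality_naturality_hom σ η, whisker_exchange_assoc,
      reassoc_of% h]
    simp [whisker_exchange]
  have hid : ∀ a : C, G.map (𝟙 (⟨a⟩ : Fractions W)) ◁ Γ a ≫ (τ.naturality (𝟙 _)).hom =
      (σ.naturality (𝟙 _)).hom ≫ Γ a ▷ G'.map (𝟙 (⟨a⟩ : Fractions W)) := by
    intro a
    rw [Pseudofunctor.StrongTrans.naturality_id_hom, Pseudofunctor.StrongTrans.naturality_id_hom,
      whisker_exchange_assoc]
    simp [whisker_exchange]
  have hcomp : ∀ {a b c : C} (f : (⟨a⟩ : Fractions W) ⟶ ⟨b⟩) (g : (⟨b⟩ : Fractions W) ⟶ ⟨c⟩),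
      G.map (f ≫ g) ◁ Γ c ≫ (τ.naturality (f ≫ g)).hom =
        (σ.naturality (f ≫ g)).hom ≫ Γ a ▷ G'.map (f ≫ g) ↔
      G.map f ◁ (G.map g ◁ Γ c ≫ (τ.naturality g).hom) ≫ (α_ _ _ _).inv ≫
          (τ.naturality f).hom ▷ G'.map g =
        G.map f ◁ (σ.naturality g).hom ≫ (α_ _ _ _).inv ≫
          ((σ.naturality f).hom ≫ Γ a ▷ G'.map f) ▷ G'.map g := by
    intro a b c f g
    rw [Pseudofunctor.StrongTrans.naturality_comp_hom, Pseudofunctor.StrongTrans.naturality_comp_hom,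
      whisker_exchange_assoc]
    have h₁ : σ.app ⟨a⟩ ◁ (G'.mapComp f g).inv ≫ Γ a ▷ G'.map (f ≫ g) =
        (α_ _ _ _).inv ≫ Γ a ▷ G'.map f ▷ G'.map g ≫ (α_ _ _ _).hom ≫
          τ.app ⟨a⟩ ◁ (G'.mapComp f g).inv := by
      rw [whisker_exchange]; simp
    simp only [Category.assoc, h₁]
    rw [cancel_epi]
    simp only [← Category.assoc]
    rw [cancel_mono, cancel_mono]
    simp only [Category.assoc, whiskerLeft_comp, comp_whiskerRight, comp_whiskerLeft,
      Iso.hom_inv_id_assoc, Iso.inv_hom_id_assoc, cancel_epi]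
  have hinv : ∀ {a b : C} {e : (⟨a⟩ : Fractions W) ⟶ ⟨b⟩} (i : AdjointInverse e),
      G.map e ◁ Γ b ≫ (τ.naturality e).hom = (σ.naturality e).hom ≫ Γ a ▷ G'.map e →
      G.map i.inv ◁ Γ a ≫ (τ.naturality i.inv).hom =
        (σ.naturality i.inv).hom ≫ Γ b ▷ G'.map i.inv := by
    intro a b e i h'
    have h := (hcomp e i.inv).1 (hiso i.unit (hid a))
    rw [← h'] at h
    refine (i.map G).whiskerLeft_cancel ?_
    have h₂ : G.map e ◁ Γ b ▷ G'.map i.inv ≫ (α_ _ _ _).inv =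
      (α_ _ _ _).inv ≫ (G.map e ◁ Γ b) ▷ G'.map i.inv := by simp
    rw [← cancel_mono (α_ _ _ _).inv, ← cancel_mono ((τ.naturality e).hom ▷ _), Category.assoc, h,
      whiskerLeft_comp, Category.assoc, Category.assoc, comp_whiskerRight, reassoc_of% h₂]
  suffices H : ∀ {a b : C} (f : Hom W a b),
      G.map f.toHom ◁ Γ b ≫ (τ.naturality f.toHom).hom =
        (σ.naturality f.toHom).hom ≫ Γ a ▷ G'.map f.toHom from @fun _ _ f => H f
  intro a b f
  induction f with
  | of f => exact hΓ f
  | id a => exact hid a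
  | comp f g ihf ihg =>
    refine (hcomp f.toHom g.toHom).2 ?_
    rw [ihg, ← ihf]
    simp
  | inv f hf => exact hinv (localizeInverse W f hf) (hΓ f)

section Extend

variable (σ : (localize W).comp G ⟶ (localize W).comp G')

open ExtendTrans

/-- Auxiliary definition for `extendTrans`. -/
def extendApp (a : Fractions W) : G.obj a ⟶ G'.obj a := σ.app a.obj

/-- Auxiliary definition for `extendTrans`. -/
def extendSquare : ∀ {a b : C} (f : Hom W a b), Square (extendApp σ) f.toHom
  | _, _, .of f => σ.naturality f
  | _, _, .inv f hf => invSquare (extendApp σ) (localizeInverse W f hf) (σ.naturality f)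
  | a, _, .id _ => idSquare (extendApp σ) ⟨a⟩
  | _, _, .comp f g => compSquare (extendApp σ) (extendSquare f) (extendSquare g)

theorem isNat_extendSquare {a b : C} {f g : Hom W a b} (η : Hom₂ W f g) :
    IsNat (extendApp σ) (extendSquare σ f) (extendSquare σ g)
      (Quot.mk _ η : f.toHom ⟶ g.toHom) := by
  have hof : ∀ {a b : C} {f g : a ⟶ b} (η : f ⟶ g), IsNat (extendApp σ) (extendSquare σ (.of f))
      (extendSquare σ (.of g)) ((localize W).map₂ η) := fun η =>
    isNat_iff.2 (σ.naturality_naturality η)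
  have hid : ∀ a : C, IsNat (extendApp σ) (extendSquare σ (.of (𝟙 a))) (extendSquare σ (.id a))
      ((localize W).mapId a).hom := fun a => isNat_idSquare (σ.naturality_id a)
  have hcomp : ∀ {a b c : C} (f : a ⟶ b) (g : b ⟶ c), IsNat (extendApp σ)
      (extendSquare σ (.of (f ≫ g))) (extendSquare σ ((Hom.of f).comp (.of g)))
      ((localize W).mapComp f g).hom := fun f g => isNat_compSquare (σ.naturality_comp f g)
  induction η with
  | id f => exact isNat_id _
  | vcomp η θ ih₁ ih₂ => exact isNat_comp ih₁ ih₂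
  | whiskerLeft f η ih => exact isNat_whiskerLeft _ ih
  | whiskerRight h η ih => exact isNat_whiskerRight _ ih
  | associator f g h => exact isNat_associator _ _ _
  | associatorInv f g h => exact isNat_inv (α_ _ _ _) (isNat_associator _ _ _)
  | leftUnitor f => exact isNat_leftUnitor _
  | leftUnitorInv f => exact isNat_inv (λ_ _) (isNat_leftUnitor _)
  | rightUnitor f => exact isNat_rightUnitor _
  | rightUnitorInv f => exact isNat_inv (ρ_ _) (isNat_rightUnitor _)
  | of η => exact hof η
  | mapId a => exact hid a
  | mapIdInv a => exact isNat_inv _ (hid a)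
  | mapComp f g => exact hcomp f g
  | mapCompInv f g => exact isNat_inv _ (hcomp f g)
  | unit f hf => exact isNat_unit (localizeInverse W f hf) _
  | unitInv f hf => exact isNat_inv (localizeInverse W f hf).unit (isNat_unit _ _)
  | counit f hf => exact isNat_counit (localizeInverse W f hf) _
  | counitInv f hf => exact isNat_inv (localizeInverse W f hf).counit (isNat_counit _ _)

/-- The extension of a pseudonatural transformation along `U_W`. -/
def extendTrans : G ⟶ G' where
  app := extendApp σ
  naturality f := extendSquare σ f
  naturality_naturality := by
    rintro _ _ _ _ ⟨η⟩
    exact isNat_iff.1 (isNat_extendSquare σ η)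
  naturality_id a := (cylId (extendApp σ) a).hom.comm.symm
  naturality_comp f g := (cylComp (extendApp σ) (extendSquare σ f) (extendSquare σ g)).hom.comm.symm

end Extend

/-- Restriction along `U_W` induces, for all pseudofunctors `G` and `G'` on `C[W⁻¹]`, an
equivalence between the category of pseudonatural transformations `G ⟶ G'` and that of
pseudonatural transformations `G ∘ U_W ⟶ G' ∘ U_W`. -/
theorem isEquivalence_restriction (G G' : Fractions W ⥤ᵖ D) :
    (restriction (localize W) G G').IsEquivalence where
  faithful := ⟨by
    intro σ τ Γ₁ Γ₂ h
    apply Pseudofunctor.StrongTrans.homCategory.ext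
    rintro ⟨a⟩
    exact congrArg (fun Λ => Λ.as.app a) h⟩
  full := ⟨fun {σ τ} Γ => ⟨⟨⟨fun a => Γ.as.app a.obj, fun f =>
    modification_naturality (fun a => Γ.as.app a) (fun f => Γ.as.naturality f) f⟩⟩, rfl⟩⟩
  essSurj := ⟨fun σ => ⟨extendTrans σ,
    ⟨Pseudofunctor.StrongTrans.isoMk (fun a => Iso.refl _) (by
      intro a b f
      exact (by simp : ((localize W).comp G).map f ◁ 𝟙 (σ.app b) ≫ (σ.naturality f).hom =
        (σ.naturality f).hom ≫ 𝟙 (σ.app a) ▷ ((localize W).comp G').map f))⟩⟩⟩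

end Restriction
end Fractions

end Fractions
end BicatFractions

open BicatFractions

/-!
The implications between the four conditions are formal once `isInternalEquivalence_localize_iff`
is known: the 1-morphisms that become internal equivalences in the bicategory of fractions are
exactly those of the saturation. Indeed (1) then says that `F` followed by the localization of `B`
sends `WA` to internal equivalences, so that (3) follows from the universal property; (2) follows
from the two-out-of-six property of internal equivalences; and the morphism of cylinders associated
to a pseudonatural equivalence at an element of `WA` has two internal equivalences as sides and an
invertible filling, so that it is an internal equivalence, with the mate of the filling as the
filling of the quasi-inverse (`IsInternalEquivalence.cyl`).

In `isInternalEquivalence_localize_iff`, elements of the saturation are inverted by two-out-of-six.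
For the converse it is enough to find, for every `f : b ⟶ c` that is inverted, some `g` with `g ≫ f`
in `W`: such a `g` is then inverted as well, and the same statement for `g` gives the second
1-morphism required by the definition of the saturation.

Since the 2-morphisms of the bicategory of fractions are generated freely, `g` is detected through
the universal property, by a pseudofunctor on `C`. Fix `c`, and for each `b` consider the category of spans from `c` to `b` whose
leg towards `c`, the denominator, lies in `W`; a morphism is a 1-morphism of apices that commutes
with the denominators up to an invertible 2-morphism and with the numerators up to an arbitrary one,
taken up to invertible 2-morphisms. The morphisms that are invertible on numerators (`cartesian`)
admit a calculus of right fractions by (BF3), (BF4b) and (BF4c)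
(`Span.hasRightCalculusOfFractions`). The localization `Roof W c b` is pseudofunctorial in `b` by
composition of numerators (`Roof.pseudofunctor`), and it is what the category of 1-morphisms from
`c` to `b` in the bicategory of fractions should be. Composition with an element of `W` is
essentially surjective by (BF3), full by (BF4a) and faithful by (BF4c), hence an equivalence
(`Roof.isInternalEquivalence_pseudofunctor_map`). So the pseudofunctor of roofs extends to the
bicategory of fractions and sends `f` to an equivalence; essential surjectivity at the identity roof
of `c` then produces `g` (`Roof.exists_comp_mem`).
-/

namespace BicatFractions

/-! ### Internal equivalences -/

namespace IsInternalEquivalence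

section

variable {C : Type u} [Bicategory.{w, v} C] {a b c d : C}

theorem of_iso {f g : a ⟶ b} (e : f ≅ g) (hf : IsInternalEquivalence f) :
    IsInternalEquivalence g := by
  obtain ⟨f', ⟨η⟩, ⟨θ⟩⟩ := hf
  exact ⟨f', ⟨η ≪≫ whiskerRightIso e f'⟩, ⟨whiskerLeftIso f' e.symm ≪≫ θ⟩⟩

theorem comp {f : a ⟶ b} {g : b ⟶ c} (hf : IsInternalEquivalence f)
    (hg : IsInternalEquivalence g) : IsInternalEquivalence (f ≫ g) := by
  obtain ⟨f', ⟨η⟩, ⟨θ⟩⟩ := hf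
  obtain ⟨g', ⟨η'⟩, ⟨θ'⟩⟩ := hg
  refine ⟨g' ≫ f', ⟨?_⟩, ⟨?_⟩⟩
  · exact η ≪≫ whiskerLeftIso f ((λ_ f').symm ≪≫ whiskerRightIso η' f' ≪≫ α_ _ _ _) ≪≫
      (α_ _ _ _).symm
  · exact α_ _ _ _ ≪≫ whiskerLeftIso g' ((α_ _ _ _).symm ≪≫ whiskerRightIso θ g ≪≫ λ_ g) ≪≫ θ'

/-- A 1-morphism with a left and a right quasi-inverse is an internal equivalence. -/
theorem of_left_right_inverse {f : a ⟶ b} {p q : b ⟶ a} (η : f ≫ p ≅ 𝟙 a) (θ : q ≫ f ≅ 𝟙 b) :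
    IsInternalEquivalence f := by
  have e : q ≅ p := (ρ_ q).symm ≪≫ whiskerLeftIso q η.symm ≪≫ (α_ _ _ _).symm ≪≫
    whiskerRightIso θ p ≪≫ λ_ p
  exact ⟨p, ⟨η.symm⟩, ⟨whiskerRightIso e.symm f ≪≫ θ⟩⟩

theorem of_comp_left {f : a ⟶ b} {g : b ⟶ c} (hf : IsInternalEquivalence f)
    (hfg : IsInternalEquivalence (f ≫ g)) : IsInternalEquivalence g := by
  obtain ⟨f', ⟨η⟩, ⟨θ⟩⟩ := hf
  have hf' : IsInternalEquivalence f' := ⟨f, ⟨θ.symm⟩, ⟨η.symm⟩⟩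
  exact (hf'.comp hfg).of_iso ((α_ _ _ _).symm ≪≫ whiskerRightIso θ g ≪≫ λ_ g)

theorem of_comp_right {f : a ⟶ b} {g : b ⟶ c} (hg : IsInternalEquivalence g)
    (hfg : IsInternalEquivalence (f ≫ g)) : IsInternalEquivalence f := by
  obtain ⟨g', ⟨η⟩, ⟨θ⟩⟩ := hg
  have hg' : IsInternalEquivalence g' := ⟨g, ⟨θ.symm⟩, ⟨η.symm⟩⟩
  exact (hfg.comp hg').of_iso (α_ _ _ _ ≪≫ whiskerLeftIso f η.symm ≪≫ ρ_ f)

/-- The part of the two-out-of-six property that concerns the last factor. -/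
theorem of_two_out_of_six {h : a ⟶ b} {g : b ⟶ c} {f : c ⟶ d}
    (hhg : IsInternalEquivalence (h ≫ g)) (hgf : IsInternalEquivalence (g ≫ f)) :
    IsInternalEquivalence f := by
  refine of_comp_left ?_ hgf
  obtain ⟨p, ⟨η⟩, -⟩ := hgf
  obtain ⟨q, -, ⟨θ⟩⟩ := hhg
  exact of_left_right_inverse ((α_ _ _ _).symm ≪≫ η.symm) (α_ _ _ _ ≪≫ θ)

end

variable {C : Type u} [Bicategory.{w, v} C] {D : Type u₁} [Bicategory.{w₁, v₁} D]

theorem map (F : C ⥤ᵖ D) {a b : C} {f : a ⟶ b} (hf : IsInternalEquivalence f) :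
    IsInternalEquivalence (F.map f) := by
  obtain ⟨i⟩ := AdjointInverse.nonempty hf
  exact (i.map F).isInternalEquivalence

theorem map_of_rightSaturation {W : MorphismProperty C} (F : C ⥤ᵖ D)
    (hF : ∀ ⦃a b : C⦄ (f : a ⟶ b), W f → IsInternalEquivalence (F.map f))
    {a b : C} {f : a ⟶ b} (hf : rightSaturation W f) : IsInternalEquivalence (F.map f) := by
  obtain ⟨_, _, g, h, hgf, hhg⟩ := hf
  exact of_two_out_of_six ((hF _ hhg).of_iso (F.mapComp h g)) ((hF _ hgf).of_iso (F.mapComp g f))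

theorem app {F G : C ⥤ᵖ D} {κ : F ⟶ G} (hκ : IsInternalEquivalence κ) (a : C) :
    IsInternalEquivalence (κ.app a) := by
  obtain ⟨κ', ⟨η⟩, ⟨θ⟩⟩ := hκ
  exact ⟨κ'.app a,
    ⟨⟨η.hom.as.app a, η.inv.as.app a,
      congrArg (fun Γ => Γ.as.app a) η.hom_inv_id, congrArg (fun Γ => Γ.as.app a) η.inv_hom_id⟩⟩,
    ⟨⟨θ.hom.as.app a, θ.inv.as.app a,
      congrArg (fun Γ => Γ.as.app a) θ.hom_inv_id, congrArg (fun Γ => Γ.as.app a) θ.inv_hom_id⟩⟩⟩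

/-- Pseudonaturally equivalent pseudofunctors send the same 1-morphisms to internal
equivalences. -/
theorem map_of_trans {F G : C ⥤ᵖ D} {κ : F ⟶ G} (hκ : IsInternalEquivalence κ) {a b : C}
    {f : a ⟶ b} (hf : IsInternalEquivalence (G.map f)) : IsInternalEquivalence (F.map f) :=
  of_comp_right (hκ.app b) (((hκ.app a).comp hf).of_iso (κ.naturality f).symm)

/-- A morphism of cylinders whose filling 2-morphism and whose two 1-morphisms are invertible (in
the appropriate sense) is an internal equivalence. The filling 2-morphism of the quasi-inverse is
the mate of the given one. -/
theorem cyl {s t : Cyl D} {e₁ : s.src ⟶ t.src} {e₂ : s.tgt ⟶ t.tgt}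
    (h₁ : IsInternalEquivalence e₁) (h₂ : IsInternalEquivalence e₂)
    (n : e₁ ≫ t.mor ≅ s.mor ≫ e₂) :
    IsInternalEquivalence (C := Cyl D) (a := s) (b := t) (Cyl.Hom.mk e₁ e₂ n.hom) := by
  obtain ⟨i₁⟩ := AdjointInverse.nonempty h₁
  obtain ⟨i₂⟩ := AdjointInverse.nonempty h₂
  let f : s ⟶ t := Cyl.Hom.mk e₁ e₂ n.hom
  let g : t ⟶ s := Cyl.Hom.mk i₁.inv i₂.inv (AdjointInverse.mate i₁ i₂ n).hom
  refine ⟨g, ⟨Cyl.mkIso (f := 𝟙 s) (g := f ≫ g) i₁.unit i₂.unit ?_⟩,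
    ⟨Cyl.mkIso (f := g ≫ f) (g := 𝟙 t) i₁.counit i₂.counit ?_⟩⟩
  · exact (AdjointInverse.unit_mate i₁ i₂ n).trans (Category.assoc _ _ _).symm
  · refine (AdjointInverse.mate_counit i₁ i₂ n).symm.trans ?_
    change _ = (_ ≫ _ ≫ _ ≫ _ ≫ _) ≫ _
    simp only [Category.assoc]
    rfl

end IsInternalEquivalence

/-! ### The category of spans with a denominator in `W` -/

section Span

variable {C : Type u} [Bicategory.{w, v} C]

/-- A span from `c` to `b` whose leg towards `c` belongs to `W`. -/
structure Span (W : MorphismProperty C) (c b : C) where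
  apex : C
  den : apex ⟶ c
  den_mem : W den
  num : apex ⟶ b

namespace Span

variable {W : MorphismProperty C} {c b b' : C}

/-- Representatives of morphisms of spans: a 1-morphism of the apices, compatible with the
denominators up to a chosen invertible 2-morphism and with the numerators up to a chosen, not
necessarily invertible, 2-morphism. -/
structure RawHom (X Y : Span W c b) where
  mid : X.apex ⟶ Y.apex
  denIso : X.den ≅ mid ≫ Y.den
  numHom : X.num ⟶ mid ≫ Y.num

namespace RawHom

variable {X Y Z : Span W c b}

/-- Two representatives are identified if they differ by an invertible 2-morphism between the
1-morphisms of the apices. -/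
def Rel (φ ψ : RawHom X Y) : Prop :=
  ∃ σ : φ.mid ≅ ψ.mid, φ.denIso.hom ≫ σ.hom ▷ Y.den = ψ.denIso.hom ∧
    φ.numHom ≫ σ.hom ▷ Y.num = ψ.numHom

variable (X Y) in
/-- The equivalence relation `RawHom.Rel`. -/
instance setoid : Setoid (RawHom X Y) where
  r := Rel
  iseqv :=
    { refl := fun φ => ⟨Iso.refl _, by simp, by simp⟩
      symm := by
        rintro φ ψ ⟨σ, h₁, h₂⟩
        exact ⟨σ.symm, by simp [← h₁], by simp [← h₂]⟩
      trans := by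
        rintro φ ψ χ ⟨σ, h₁, h₂⟩ ⟨τ, h₃, h₄⟩
        exact ⟨σ ≪≫ τ, by simp [← h₃, ← h₁], by simp [← h₄, ← h₂]⟩ }

/-- Representatives with the same 1-morphism of the apices and equal 2-morphisms are identified. -/
theorem rel_of_eq {m : X.apex ⟶ Y.apex} {d d' : X.den ≅ m ≫ Y.den} {n n' : X.num ⟶ m ≫ Y.num}
    (hd : d.hom = d'.hom) (hn : n = n') : (⟨m, d, n⟩ : RawHom X Y) ≈ ⟨m, d', n'⟩ :=
  ⟨Iso.refl _, by simp [hd], by simp [hn]⟩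

/-- The identity representative. -/
abbrev id (X : Span W c b) : RawHom X X := ⟨𝟙 _, (λ_ _).symm, (λ_ _).inv⟩

/-- Composition of representatives. -/
abbrev comp (φ : RawHom X Y) (ψ : RawHom Y Z) : RawHom X Z :=
  ⟨φ.mid ≫ ψ.mid, φ.denIso ≪≫ whiskerLeftIso _ ψ.denIso ≪≫ (α_ _ _ _).symm,
    φ.numHom ≫ φ.mid ◁ ψ.numHom ≫ (α_ _ _ _).inv⟩

theorem comp_congr {φ φ' : RawHom X Y} {ψ ψ' : RawHom Y Z} (h : φ ≈ φ') (h' : ψ ≈ ψ') :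
    φ.comp ψ ≈ φ'.comp ψ' := by
  obtain ⟨σ, h₁, h₂⟩ := h
  obtain ⟨τ, h₃, h₄⟩ := h'
  refine ⟨whiskerRightIso σ _ ≪≫ whiskerLeftIso _ τ, ?_, ?_⟩
  · simp [← h₁, ← h₃, ← whisker_exchange_assoc]
  · simp [← h₂, ← h₄, ← whisker_exchange_assoc]

end RawHom

/-- Morphisms of spans are representatives up to invertible 2-morphisms. -/
instance : CategoryStruct (Span W c b) where
  Hom X Y := Quotient (RawHom.setoid X Y)
  id X := Quotient.mk _ (RawHom.id X)
  comp := Quotient.map₂ RawHom.comp fun _ _ h _ _ h' => RawHom.comp_congr h h'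

/-- The morphism of spans given by a representative. -/
def homMk {X Y : Span W c b} (φ : RawHom X Y) : X ⟶ Y := Quotient.mk _ φ

theorem homMk_surjective {X Y : Span W c b} (f : X ⟶ Y) : ∃ φ : RawHom X Y, homMk φ = f :=
  Quotient.exists_rep f

theorem homMk_eq_iff {X Y : Span W c b} {φ ψ : RawHom X Y} : homMk φ = homMk ψ ↔
    ∃ σ : φ.mid ≅ ψ.mid, φ.denIso.hom ≫ σ.hom ▷ Y.den = ψ.denIso.hom ∧
      φ.numHom ≫ σ.hom ▷ Y.num = ψ.numHom :=
  Quotient.eq (r := RawHom.setoid X Y)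

instance : Category (Span W c b) where
  id_comp f := by
    obtain ⟨φ, rfl⟩ := homMk_surjective f
    exact homMk_eq_iff.2 ⟨λ_ _, by simp, by simp⟩
  comp_id f := by
    obtain ⟨φ, rfl⟩ := homMk_surjective f
    exact homMk_eq_iff.2 ⟨ρ_ _, by simp, by simp⟩
  assoc f g h := by
    obtain ⟨φ, rfl⟩ := homMk_surjective f
    obtain ⟨ψ, rfl⟩ := homMk_surjective g
    obtain ⟨χ, rfl⟩ := homMk_surjective h
    exact homMk_eq_iff.2 ⟨α_ _ _ _, by simp, by simp⟩

/-- Changing the numerator of a span. -/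
abbrev withNum (X : Span W c b) (g : X.apex ⟶ b') : Span W c b' := ⟨X.apex, X.den, X.den_mem, g⟩

/-- The morphism of spans induced by a 2-morphism between numerators. -/
def vert (X : Span W c b) {f g : X.apex ⟶ b'} (η : f ⟶ g) : X.withNum f ⟶ X.withNum g :=
  homMk ⟨𝟙 _, (λ_ _).symm, η ≫ (λ_ _).inv⟩

theorem vert_id (X : Span W c b) (f : X.apex ⟶ b') : X.vert (𝟙 f) = 𝟙 (X.withNum f) :=
  Quotient.sound (RawHom.rel_of_eq rfl (by simp))

theorem vert_comp (X : Span W c b) {f g h : X.apex ⟶ b'} (η : f ⟶ g) (θ : g ⟶ h) :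
    X.vert (η ≫ θ) = X.vert η ≫ X.vert θ :=
  homMk_eq_iff.2 ⟨(λ_ _).symm, by simp; bicategory, by simp; bicategory⟩

/-- Composition of the numerators with a 1-morphism, on representatives. -/
abbrev RawHom.push (k : b ⟶ b') {X Y : Span W c b} (φ : RawHom X Y) :
    RawHom (X.withNum (X.num ≫ k)) (Y.withNum (Y.num ≫ k)) :=
  ⟨φ.mid, φ.denIso, φ.numHom ▷ k ≫ (α_ _ _ _).hom⟩

/-- Composition of the numerators with a 1-morphism. -/
def push (k : b ⟶ b') : Span W c b ⥤ Span W c b' where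
  obj X := X.withNum (X.num ≫ k)
  map := Quotient.map (RawHom.push k) (by
    rintro φ ψ ⟨σ, h₁, h₂⟩
    exact ⟨σ, h₁, by simp [← h₂]⟩)
  map_id X := Quotient.sound (RawHom.rel_of_eq rfl (by simp))
  map_comp f g := by
    obtain ⟨φ, rfl⟩ := homMk_surjective f
    obtain ⟨ψ, rfl⟩ := homMk_surjective g
    exact Quotient.sound (RawHom.rel_of_eq rfl (by simp))

theorem push_map_vert {b'' : C} (k : b ⟶ b') (X : Span W c b'') {f g : X.apex ⟶ b} (η : f ⟶ g) :
    (push k).map (X.vert η) = X.vert (η ▷ k) :=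
  Quotient.sound (RawHom.rel_of_eq rfl (by simp))

/-- Naturality in the span of the comparison given by a 2-morphism. -/
theorem vert_naturality {k k' : b ⟶ b'} (η : k ⟶ k') {X Y : Span W c b} (f : X ⟶ Y) :
    (push k).map f ≫ Y.vert (Y.num ◁ η) = X.vert (X.num ◁ η) ≫ (push k').map f := by
  obtain ⟨φ, rfl⟩ := homMk_surjective f
  change homMk (φ.push k) ≫ _ = _ ≫ homMk (φ.push k')
  exact homMk_eq_iff.2 ⟨ρ_ _ ≪≫ (λ_ _).symm, by simp, by simp [whisker_exchange_assoc]⟩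

theorem vert_rightUnitor_naturality {X Y : Span W c b} (f : X ⟶ Y) :
    (push (𝟙 b)).map f ≫ Y.vert (ρ_ Y.num).hom = X.vert (ρ_ X.num).hom ≫ f := by
  obtain ⟨φ, rfl⟩ := homMk_surjective f
  change homMk (φ.push (𝟙 b)) ≫ _ = _
  exact homMk_eq_iff.2 ⟨ρ_ _ ≪≫ (λ_ _).symm, by simp, by simp⟩

theorem vert_associator_naturality {b'' : C} (k : b ⟶ b') (l : b' ⟶ b'') {X Y : Span W c b}
    (f : X ⟶ Y) : (push (k ≫ l)).map f ≫ Y.vert (α_ Y.num k l).inv =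
      X.vert (α_ X.num k l).inv ≫ (push l).map ((push k).map f) := by
  obtain ⟨φ, rfl⟩ := homMk_surjective f
  change homMk (φ.push (k ≫ l)) ≫ _ = _ ≫ homMk ((φ.push k).push l)
  exact homMk_eq_iff.2 ⟨ρ_ _ ≪≫ (λ_ _).symm, by simp, by simp⟩

/-- The morphisms of spans that are invertible on numerators. -/
def cartesian (W : MorphismProperty C) (c b : C) : MorphismProperty (Span W c b) :=
  fun X Y f => ∃ φ : RawHom X Y, homMk φ = f ∧ IsIso φ.numHom

theorem cartesian_push (k : b ⟶ b') {X Y : Span W c b} {f : X ⟶ Y} (hf : cartesian W c b f) :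
    cartesian W c b' ((push k).map f) := by
  obtain ⟨φ, rfl, h⟩ := hf
  exact ⟨φ.push k, rfl, inferInstanceAs (IsIso (φ.numHom ▷ k ≫ (α_ φ.mid Y.num k).hom))⟩

end Span

end Span

/-! ### Natural transformations out of a localized category -/

section Localization

variable {E : Type u} [Category.{v} E] {S : MorphismProperty E} {D : Type u₁} [Category.{v₁} D]

/-- Only objects in the image of `S.Q` have to be tested, since `S.Q` is bijective on objects. -/
theorem localization_natTrans_ext {F G : S.Localization ⥤ D} {τ₁ τ₂ : F ⟶ G}
    (h : ∀ X : E, τ₁.app (S.Q.obj X) = τ₂.app (S.Q.obj X)) : τ₁ = τ₂ := by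
  ext X
  obtain ⟨X, rfl⟩ := (Localization.Construction.objEquiv S).surjective X
  exact h X

/-- A natural transformation between functors on a localized category, given by its components
at the objects of the original category. -/
noncomputable def localizationNatTrans {F G : S.Localization ⥤ D}
    (app : ∀ X, F.obj (S.Q.obj X) ⟶ G.obj (S.Q.obj X))
    (naturality : ∀ ⦃X Y : E⦄ (f : X ⟶ Y),
      F.map (S.Q.map f) ≫ app Y = app X ≫ G.map (S.Q.map f)) : F ⟶ G :=
  Localization.Construction.natTransExtension
    { app := app, naturality := naturality }

@[simp]
theorem localizationNatTrans_app {F G : S.Localization ⥤ D}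
    (app : ∀ X, F.obj (S.Q.obj X) ⟶ G.obj (S.Q.obj X)) (naturality) (X : E) :
    (localizationNatTrans (F := F) (G := G) app naturality).app (S.Q.obj X) = app X :=
  Localization.Construction.NatTransExtension.app_eq _ X

/-- A natural isomorphism between functors on a localized category, given by its components
at the objects of the original category. -/
noncomputable def localizationNatIso {F G : S.Localization ⥤ D}
    (app : ∀ X, F.obj (S.Q.obj X) ≅ G.obj (S.Q.obj X))
    (naturality : ∀ ⦃X Y : E⦄ (f : X ⟶ Y),
      F.map (S.Q.map f) ≫ (app Y).hom = (app X).hom ≫ G.map (S.Q.map f)) : F ≅ G where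
  hom := localizationNatTrans (fun X => (app X).hom) naturality
  inv := localizationNatTrans (fun X => (app X).inv) fun X Y f => by
    rw [Iso.comp_inv_eq, Category.assoc, naturality, Iso.inv_hom_id_assoc]
  hom_inv_id := localization_natTrans_ext fun X => by simp
  inv_hom_id := localization_natTrans_ext fun X => by simp

@[simp]
theorem localizationNatIso_hom_app {F G : S.Localization ⥤ D}
    (app : ∀ X, F.obj (S.Q.obj X) ≅ G.obj (S.Q.obj X)) (naturality) (X : E) :
    (localizationNatIso (F := F) (G := G) app naturality).hom.app (S.Q.obj X) = (app X).hom :=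
  localizationNatTrans_app _ _ X

@[simp]
theorem localizationNatIso_inv_app {F G : S.Localization ⥤ D}
    (app : ∀ X, F.obj (S.Q.obj X) ≅ G.obj (S.Q.obj X)) (naturality) (X : E) :
    (localizationNatIso (F := F) (G := G) app naturality).inv.app (S.Q.obj X) = (app X).inv :=
  localizationNatTrans_app _ _ X

theorem localization_lift_map_Q (F : E ⥤ D) (hF : S.IsInvertedBy F) {X Y : E} (f : X ⟶ Y) :
    (Localization.Construction.lift F hF).map (S.Q.map f) = F.map f := by
  refine (Functor.congr_hom (Localization.Construction.fac F hF) f).trans ?_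
  exact (Category.id_comp _).trans (Category.comp_id _)

end Localization

/-! ### The pseudofunctor of roofs -/

section Roof

variable {C : Type u} [Bicategory.{w, v} C] (W : MorphismProperty C) (c : C)

/-- The category of roofs from `c` to `b`: spans with a denominator in `W`, with the morphisms
that are invertible on numerators inverted. It models the category of 1-morphisms from `c` to `b`
in `C[W⁻¹]`. -/
abbrev Roof (b : C) := (Span.cartesian W c b).Localization

namespace Roof

variable {W c} {b b' b'' : C}

open BicatFractions.Span

/-- The roof given by a span. -/
noncomputable abbrev Q : Span W c b ⥤ Roof W c b := (Span.cartesian W c b).Q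

/-- The isomorphism of roofs given by an invertible 2-morphism between numerators. -/
noncomputable def vertIso (X : Span W c b) {f g : X.apex ⟶ b'} (η : f ≅ g) :
    Q.obj (X.withNum f) ≅ Q.obj (X.withNum g) where
  hom := Q.map (X.vert η.hom)
  inv := Q.map (X.vert η.inv)
  hom_inv_id := by rw [← Functor.map_comp, ← vert_comp, η.hom_inv_id, vert_id,
      CategoryTheory.Functor.map_id]
  inv_hom_id := by rw [← Functor.map_comp, ← vert_comp, η.inv_hom_id, vert_id,
      CategoryTheory.Functor.map_id]

theorem isInvertedBy_push (k : b ⟶ b') :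
    (Span.cartesian W c b).IsInvertedBy (push k ⋙ Q) := fun _ _ f hf =>
  MorphismProperty.Q_inverts _ ((push k).map f) (cartesian_push k hf)

/-- Composition of a roof with a 1-morphism. -/
noncomputable def postcomp (k : b ⟶ b') : Roof W c b ⥤ Roof W c b' :=
  Localization.Construction.lift (push k ⋙ Q) (isInvertedBy_push k)

theorem postcomp_map_Q (k : b ⟶ b') {X Y : Span W c b} (f : X ⟶ Y) :
    (postcomp k).map (Q.map f) = Q.map ((push k).map f) :=
  localization_lift_map_Q _ _ f

theorem postcomp_map_vert (k : b ⟶ b') (X : Span W c b'') {f g : X.apex ⟶ b} (η : f ⟶ g) :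
    (postcomp k).map (Q.map (X.vert η)) = Q.map (X.vert (η ▷ k)) :=
  (postcomp_map_Q k _).trans (congrArg Q.map (push_map_vert k X η))

/-- Composition of roofs with a 2-morphism. -/
noncomputable def postcompTrans {k k' : b ⟶ b'} (η : k ⟶ k') :
    postcomp (W := W) (c := c) k ⟶ postcomp k' :=
  localizationNatTrans (fun X => Q.map (X.vert (X.num ◁ η))) fun X Y f => by
    rw [postcomp_map_Q, postcomp_map_Q]
    exact (Q.map_comp _ _).symm.trans ((congrArg Q.map (vert_naturality η f)).trans
      (Q.map_comp _ _))

variable (W c b) in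
/-- Composition of roofs with an identity. -/
noncomputable def postcompId : postcomp (W := W) (c := c) (𝟙 b) ≅ 𝟭 _ :=
  localizationNatIso (fun X => vertIso X (ρ_ X.num)) fun X Y f => by
    rw [postcomp_map_Q]
    exact (Q.map_comp _ _).symm.trans ((congrArg Q.map (vert_rightUnitor_naturality f)).trans
      (Q.map_comp _ _))

/-- Composition of roofs with a composite. -/
noncomputable def postcompComp (k : b ⟶ b') (l : b' ⟶ b'') :
    postcomp (W := W) (c := c) (k ≫ l) ≅ postcomp k ⋙ postcomp l :=
  localizationNatIso (fun X => vertIso X (α_ X.num k l).symm) fun X Y f => by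
    rw [postcomp_map_Q, Functor.comp_map, postcomp_map_Q]
    refine Eq.trans ?_ (congrArg (_ ≫ ·) (postcomp_map_Q l ((push k).map f)).symm)
    exact (Q.map_comp _ _).symm.trans ((congrArg Q.map (vert_associator_naturality k l f)).trans
      (Q.map_comp _ _))

theorem postcompTrans_app {k k' : b ⟶ b'} (η : k ⟶ k') (X : Span W c b) :
    (postcompTrans η).app (Q.obj X) = Q.map (X.vert (X.num ◁ η)) :=
  localizationNatTrans_app _ _ X

theorem postcompId_hom_app (X : Span W c b) :
    (postcompId W c b).hom.app (Q.obj X) = Q.map (X.vert (ρ_ X.num).hom) :=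
  localizationNatIso_hom_app _ _ X

theorem postcompComp_hom_app (k : b ⟶ b') (l : b' ⟶ b'') (X : Span W c b) :
    (postcompComp k l).hom.app (Q.obj X) = Q.map (X.vert (α_ X.num k l).inv) :=
  localizationNatIso_hom_app _ _ X

theorem postcompComp_inv_app (k : b ⟶ b') (l : b' ⟶ b'') (X : Span W c b) :
    (postcompComp k l).inv.app (Q.obj X) = Q.map (X.vert (α_ X.num k l).hom) :=
  localizationNatIso_inv_app _ _ X

theorem Q_map_vert_comp (X : Span W c b) {f g h : X.apex ⟶ b'} (η : f ⟶ g) (θ : g ⟶ h) :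
    Q.map (X.vert η) ≫ Q.map (X.vert θ) = Q.map (X.vert (η ≫ θ)) := by
  rw [vert_comp, Functor.map_comp]

theorem postcompTrans_id (k : b ⟶ b') :
    postcompTrans (W := W) (c := c) (𝟙 k) = 𝟙 _ :=
  localization_natTrans_ext fun X => by
    rw [postcompTrans_app, whiskerLeft_id, vert_id]
    exact Q.map_id _

theorem postcompTrans_comp {k l m : b ⟶ b'} (η : k ⟶ l) (θ : l ⟶ m) :
    postcompTrans (W := W) (c := c) (η ≫ θ) = postcompTrans η ≫ postcompTrans θ :=
  localization_natTrans_ext fun X => by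
    rw [NatTrans.comp_app, postcompTrans_app, postcompTrans_app, postcompTrans_app,
      whiskerLeft_comp]
    exact (Q_map_vert_comp X _ _).symm

variable (W c) in
/-- The pseudofunctor sending `b` to the category of roofs from `c` to `b`. -/
noncomputable def pseudofunctor : C ⥤ᵖ Cat.{max u v w, max u v} where
  obj b := Cat.of (Roof W c b)
  map k := (postcomp k).toCatHom
  map₂ η := (postcompTrans η).toCatHom₂
  map₂_id k := congrArg NatTrans.toCatHom₂ (postcompTrans_id k)
  map₂_comp η θ := congrArg NatTrans.toCatHom₂ (postcompTrans_comp η θ)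
  mapId b := Cat.Hom.isoMk (postcompId W c b)
  mapComp k l := Cat.Hom.isoMk (postcompComp k l)
  map₂_whisker_left k l m η := Cat.Hom₂.ext (localization_natTrans_ext fun X => by
    change (postcompTrans (k ◁ η)).app (Q.obj X) = (postcompComp k l).hom.app (Q.obj X) ≫
      (postcompTrans η).app (Q.obj ((push k).obj X)) ≫ (postcompComp k m).inv.app (Q.obj X)
    rw [postcompTrans_app, postcompTrans_app, postcompComp_hom_app, postcompComp_inv_app]
    refine Eq.trans ?_ (congrArg (_ ≫ ·) (Q_map_vert_comp X _ _).symm)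
    refine Eq.trans ?_ (Q_map_vert_comp X _ _).symm
    exact congrArg (fun θ => Q.map (X.vert θ)) (by simp : X.num ◁ k ◁ η =
      (α_ X.num k l).inv ≫ (X.num ≫ k) ◁ η ≫ (α_ X.num k m).hom))
  map₂_whisker_right {_ _ _ k k'} η l := Cat.Hom₂.ext (localization_natTrans_ext fun X => by
    change (postcompTrans (η ▷ l)).app (Q.obj X) = (postcompComp k l).hom.app (Q.obj X) ≫
      (postcomp l).map ((postcompTrans η).app (Q.obj X)) ≫ (postcompComp k' l).inv.app (Q.obj X)
    rw [postcompTrans_app, postcompTrans_app, postcompComp_hom_app, postcompComp_inv_app]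
    refine Eq.trans ?_ (congrArg (_ ≫ · ≫ _) (postcomp_map_vert l X _).symm)
    refine Eq.trans ?_ (congrArg (_ ≫ ·) (Q_map_vert_comp X _ _).symm)
    refine Eq.trans ?_ (Q_map_vert_comp X _ _).symm
    exact congrArg (fun θ => Q.map (X.vert θ)) (by simp : X.num ◁ η ▷ l =
      (α_ X.num k l).inv ≫ (X.num ◁ η) ▷ l ≫ (α_ X.num k' l).hom))
  map₂_associator k l m := Cat.Hom₂.ext (localization_natTrans_ext fun X => by
    change (postcompTrans (α_ k l m).hom).app (Q.obj X) =
      (postcompComp (k ≫ l) m).hom.app (Q.obj X) ≫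
        (postcomp m).map ((postcompComp k l).hom.app (Q.obj X)) ≫ 𝟙 _ ≫
          (postcompComp l m).inv.app (Q.obj ((push k).obj X)) ≫
            (postcompComp k (l ≫ m)).inv.app (Q.obj X)
    rw [postcompTrans_app, postcompComp_hom_app, postcompComp_hom_app, postcompComp_inv_app,
      postcompComp_inv_app, Category.id_comp]
    refine Eq.trans ?_ (congrArg (_ ≫ · ≫ _) (postcomp_map_vert m X _).symm)
    refine Eq.trans ?_ (congrArg (_ ≫ _ ≫ ·) (Q_map_vert_comp X _ _).symm)
    refine Eq.trans ?_ (congrArg (_ ≫ ·) (Q_map_vert_comp X _ _).symm)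
    refine Eq.trans ?_ (Q_map_vert_comp X _ _).symm
    exact congrArg (fun θ => Q.map (X.vert θ)) (by simp : X.num ◁ (α_ k l m).hom =
      (α_ X.num (k ≫ l) m).inv ≫ (α_ X.num k l).inv ▷ m ≫ (α_ (X.num ≫ k) l m).hom ≫
        (α_ X.num k (l ≫ m)).hom))
  map₂_left_unitor {a _} k := Cat.Hom₂.ext (localization_natTrans_ext fun X => by
    change (postcompTrans (λ_ k).hom).app (Q.obj X) = (postcompComp (𝟙 a) k).hom.app (Q.obj X) ≫
      (postcomp k).map ((postcompId W c a).hom.app (Q.obj X)) ≫ 𝟙 _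
    rw [postcompTrans_app, postcompComp_hom_app, postcompId_hom_app, Category.comp_id]
    refine Eq.trans ?_ (congrArg (_ ≫ ·) (postcomp_map_vert k X (ρ_ X.num).hom).symm)
    refine Eq.trans ?_ (Q_map_vert_comp X _ _).symm
    exact congrArg (fun θ => Q.map (X.vert θ)) (by simp : X.num ◁ (λ_ k).hom =
      (α_ X.num (𝟙 a) k).inv ≫ (ρ_ X.num).hom ▷ k))
  map₂_right_unitor {_ b} k := Cat.Hom₂.ext (localization_natTrans_ext fun X => by
    change (postcompTrans (ρ_ k).hom).app (Q.obj X) = (postcompComp k (𝟙 b)).hom.app (Q.obj X) ≫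
      (postcompId W c b).hom.app (Q.obj ((push k).obj X)) ≫ 𝟙 _
    rw [postcompTrans_app, postcompComp_hom_app, postcompId_hom_app]
    refine Eq.trans ?_ (congrArg (_ ≫ ·) (Category.comp_id _).symm)
    refine Eq.trans ?_ (Q_map_vert_comp X _ _).symm
    exact congrArg (fun θ => Q.map (X.vert θ)) (by simp : X.num ◁ (ρ_ k).hom =
      (α_ X.num k (𝟙 b)).inv ≫ (ρ_ (X.num ≫ k)).hom))

end Roof

end Roof

/-! ### Consequences of the conditions (BF) -/

namespace SatisfiesBF

variable {C : Type u} [Bicategory.{w, v} C] {W : MorphismProperty C}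

/-- (BF4b), stated for isomorphisms. -/
theorem exists_lift_iso (hW : SatisfiesBF W) {a b c : C} {f₁ f₂ : c ⟶ b} {w : b ⟶ a} (hw : W w)
    (α : f₁ ≫ w ≅ f₂ ≫ w) : ∃ (d : C) (r : d ⟶ c) (σ : r ≫ f₁ ≅ r ≫ f₂), W r ∧
      r ◁ α.hom = (α_ r f₁ w).inv ≫ σ.hom ▷ w ≫ (α_ r f₂ w).hom := by
  obtain ⟨d, r, β, hr, _, h⟩ := hW.bf4b w f₁ f₂ α.hom hw inferInstance
  exact ⟨d, r, asIso β, hr, h⟩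

/-- Whiskering with an element of `W` is faithful up to refinement. This is (BF4c) applied to two
lifts of `β ▷ w` along the identity. -/
theorem exists_whiskerLeft_eq (hW : SatisfiesBF W) {a b c : C} {f₁ f₂ : c ⟶ b} {w : b ⟶ a}
    (hw : W w) {β β' : f₁ ⟶ f₂} (h : β ▷ w = β' ▷ w) :
    ∃ (d : C) (r : d ⟶ c), W r ∧ r ◁ β = r ◁ β' := by
  obtain ⟨e, s, s', ζ, hs, H⟩ := hW.bf4c w f₁ f₂ (β ▷ w) hw (𝟙 c) (𝟙 c ◁ β) (𝟙 c) (𝟙 c ◁ β')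
    (hW.bf1 c) (hW.bf1 c) (by simp) (by simp [h])
  refine ⟨e, s ≫ 𝟙 c, hs, ?_⟩
  have h₁ : ζ.hom ▷ f₁ ≫ (s' ≫ 𝟙 c) ◁ β' = (s ≫ 𝟙 c) ◁ β ≫ ζ.hom ▷ f₂ := by
    simpa using H
  -- By the exchange law both sides contain `ζ.hom ▷ f₂`, which can be cancelled.
  rw [← whisker_exchange] at h₁
  exact ((cancel_mono _).1 h₁).symm

/-- An invertible 2-morphism `δ` can be lifted along `v` in such a way that the lift agrees with a
given lift `θ` of it along `v'`, where `v` factors as `t ≫ v'`. -/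
theorem exists_lift_iso_compatible (hW : SatisfiesBF W) {a b b' c : C} {s₁ s₂ : c ⟶ b}
    {v : b ⟶ a} {v' : b' ⟶ a} {t : b ⟶ b'} (hv : W v) (hv' : W v') (ξ : v ≅ t ≫ v')
    (δ : s₁ ≫ v ≅ s₂ ≫ v) (θ : s₁ ≫ t ≅ s₂ ≫ t) (h : s₁ ◁ ξ.hom ≫ (α_ _ _ _).inv ≫ θ.hom ▷ v' =
      δ.hom ≫ s₂ ◁ ξ.hom ≫ (α_ _ _ _).inv) :
    ∃ (d : C) (r : d ⟶ c) (σ : r ≫ s₁ ≅ r ≫ s₂), W r ∧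
      r ◁ δ.hom = (α_ r s₁ v).inv ≫ σ.hom ▷ v ≫ (α_ r s₂ v).hom ∧
      r ◁ θ.hom = (α_ r s₁ t).inv ≫ σ.hom ▷ t ≫ (α_ r s₂ t).hom := by
  obtain ⟨d, r, σ, hr, H⟩ := hW.exists_lift_iso hv δ
  -- The lift `σ` of `δ` and the given lift `θ` induce the same 2-morphism along `v'`, so they agree
  -- after a further refinement.
  have key : ((α_ r s₁ t).inv ≫ σ.hom ▷ t ≫ (α_ r s₂ t).hom) ▷ v' = (r ◁ θ.hom) ▷ v' := by
    have h₁ : r ◁ (s₁ ◁ ξ.hom ≫ (α_ _ _ _).inv ≫ θ.hom ▷ v') =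
      r ◁ (δ.hom ≫ s₂ ◁ ξ.hom ≫ (α_ _ _ _).inv) := congrArg (r ◁ ·) h
    rw [whiskerLeft_comp, whiskerLeft_comp r δ.hom, H] at h₁
    rw [← cancel_epi ((α_ r (s₁ ≫ t) v').inv), ← cancel_epi (r ◁ (α_ s₁ t v').inv),
      ← cancel_epi (r ◁ s₁ ◁ ξ.hom)]
    have h₂ : σ.hom ▷ v ≫ (r ≫ s₂) ◁ ξ.hom = (r ≫ s₁) ◁ ξ.hom ≫ σ.hom ▷ (t ≫ v') :=
      (whisker_exchange _ _).symm
    rw [← cancel_mono ((α_ r (s₂ ≫ t) v').hom)]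
    trans r ◁ s₁ ◁ ξ.hom ≫ r ◁ ((α_ _ _ _).inv ≫ θ.hom ▷ v')
    · rw [h₁]
      calc
        _ = (α_ _ _ _).inv ≫ ((r ≫ s₁) ◁ ξ.hom ≫ σ.hom ▷ (t ≫ v')) ≫
            (α_ _ _ _).hom ≫ r ◁ (α_ _ _ _).inv := by simp
        _ = _ := by rw [← h₂]; simp
    · simp
  obtain ⟨e, z, hz, Hz⟩ := hW.exists_whiskerLeft_eq hv' key
  refine ⟨e, z ≫ r, α_ _ _ _ ≪≫ whiskerLeftIso z σ ≪≫ (α_ _ _ _).symm, hW.bf2 _ _ hz hr, ?_, ?_⟩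
  · rw [comp_whiskerLeft, H]
    simp
  · rw [comp_whiskerLeft, ← Hz]
    simp

end SatisfiesBF

/-! ### The calculus of fractions for spans -/

namespace Span

variable {C : Type u} [Bicategory.{w, v} C] {W : MorphismProperty C} {c b b' : C}

/-- Precomposition of both legs of a span with a 1-morphism. -/
abbrev restrict (X : Span W c b) {e : C} (r : e ⟶ X.apex) (hr : W (r ≫ X.den)) : Span W c b :=
  ⟨e, r ≫ X.den, hr, r ≫ X.num⟩

/-- The representative of the morphism to a span from one of its restrictions. -/
abbrev restrictRawHom (X : Span W c b) {e : C} (r : e ⟶ X.apex) (hr : W (r ≫ X.den)) :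
    RawHom (X.restrict r hr) X := ⟨r, Iso.refl _, 𝟙 _⟩

theorem cartesian_restrict (X : Span W c b) {e : C} (r : e ⟶ X.apex) (hr : W (r ≫ X.den)) :
    cartesian W c b (homMk (X.restrictRawHom r hr)) :=
  ⟨_, rfl, inferInstanceAs (IsIso (𝟙 _))⟩

instance : (cartesian W c b).IsMultiplicative where
  id_mem X := ⟨RawHom.id X, rfl, inferInstanceAs (IsIso (λ_ _).inv)⟩
  comp_mem f g hf hg := by
    obtain ⟨φ, rfl, h⟩ := hf
    obtain ⟨ψ, rfl, h'⟩ := hg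
    exact ⟨φ.comp ψ, rfl,
      inferInstanceAs (IsIso (φ.numHom ≫ φ.mid ◁ ψ.numHom ≫ (α_ _ _ _).inv))⟩

/-- The Ore condition: (BF3) completes the denominators to a square, and (BF4b) makes the square of
apices commute. -/
theorem exists_rightFraction (hW : SatisfiesBF W) {X Y Y' : Span W c b} (f : X ⟶ Y) (g : Y' ⟶ Y)
    (hg : cartesian W c b g) : ∃ (Z : Span W c b) (s : Z ⟶ X) (k : Z ⟶ Y'),
      cartesian W c b s ∧ s ≫ f = k ≫ g := by
  obtain ⟨⟨s, ζ, β⟩, rfl⟩ := homMk_surjective f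
  obtain ⟨⟨t, ξ, γ⟩, rfl, hγ⟩ := hg
  replace hγ : IsIso γ := hγ
  obtain ⟨d, p, p', hp, ⟨ι⟩⟩ := hW.bf3 Y'.den X.den Y'.den_mem
  obtain ⟨e, q, σ, hq, H⟩ := hW.exists_lift_iso Y.den_mem
    (α_ p s Y.den ≪≫ whiskerLeftIso p ζ.symm ≪≫ ι ≪≫ whiskerLeftIso p' ξ ≪≫ (α_ p' t Y.den).symm)
  let τ : (q ≫ p) ≫ s ≅ (q ≫ p') ≫ t := α_ _ _ _ ≪≫ σ ≪≫ (α_ _ _ _).symm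
  let hr : W ((q ≫ p) ≫ X.den) := hW.bf2 _ _ (hW.bf2 _ _ hq hp) X.den_mem
  let k : RawHom (X.restrict (q ≫ p) hr) Y' :=
    ⟨q ≫ p', α_ _ _ _ ≪≫ whiskerLeftIso q ι ≪≫ (α_ _ _ _).symm,
      (q ≫ p) ◁ β ≫ (α_ _ _ _).inv ≫ τ.hom ▷ Y.num ≫ (α_ _ _ _).hom ≫ (q ≫ p') ◁ inv γ⟩
  refine ⟨_, _, homMk k, X.cartesian_restrict (q ≫ p) hr, homMk_eq_iff.2 ⟨τ, ?_, ?_⟩⟩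
  · have e₁ : σ.hom ▷ Y.den = (α_ _ _ _).hom ≫ q ◁ ((α_ p s Y.den).hom ≫ p ◁ ζ.inv ≫ ι.hom ≫
        p' ◁ ξ.hom ≫ (α_ p' t Y.den).inv) ≫ (α_ _ _ _).inv := by
      rw [← cancel_epi (α_ _ _ _).inv, Iso.inv_hom_id_assoc, ← cancel_mono (α_ _ _ _).hom,
        Category.assoc, ← H]
      simp
    simp [k, τ, e₁]
  · simp [k]

/-- The cancellation condition: two morphisms of spans that agree after composition with a
cartesian morphism agree after restriction. The 2-morphism between the 1-morphisms of the apices is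
obtained by lifting along the denominator of `Y`; the choice has to be compatible with the one
given along the denominator of `Y'`, so that it respects the numerators. -/
theorem exists_precomp_eq (hW : SatisfiesBF W) {X Y Y' : Span W c b} (f₁ f₂ : X ⟶ Y) (g : Y ⟶ Y')
    (hg : cartesian W c b g) (h : f₁ ≫ g = f₂ ≫ g) :
    ∃ (Z : Span W c b) (s : Z ⟶ X), cartesian W c b s ∧ s ≫ f₁ = s ≫ f₂ := by
  obtain ⟨⟨s₁, ζ₁, β₁⟩, rfl⟩ := homMk_surjective f₁
  obtain ⟨⟨s₂, ζ₂, β₂⟩, rfl⟩ := homMk_surjective f₂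
  obtain ⟨⟨t, ξ, γ⟩, rfl, hγ⟩ := hg
  replace hγ : IsIso γ := hγ
  obtain ⟨θ, hd, hn⟩ := homMk_eq_iff.1 h
  replace hd : (ζ₁.hom ≫ s₁ ◁ ξ.hom ≫ (α_ _ _ _).inv) ≫ θ.hom ▷ Y'.den =
    ζ₂.hom ≫ s₂ ◁ ξ.hom ≫ (α_ _ _ _).inv := hd
  replace hn : (β₁ ≫ s₁ ◁ γ ≫ (α_ _ _ _).inv) ≫ θ.hom ▷ Y'.num =
    β₂ ≫ s₂ ◁ γ ≫ (α_ _ _ _).inv := hn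
  obtain ⟨e, r, σ, hr, h₁, h₂⟩ := hW.exists_lift_iso_compatible Y.den_mem Y'.den_mem ξ
    (ζ₁.symm ≪≫ ζ₂) θ (by simp [← hd])
  refine ⟨_, _, X.cartesian_restrict r (hW.bf2 _ _ hr X.den_mem), homMk_eq_iff.2 ⟨σ, ?_, ?_⟩⟩
  · have : r ◁ ζ₂.hom = r ◁ ζ₁.hom ≫ (α_ r s₁ Y.den).inv ≫ σ.hom ▷ Y.den ≫ (α_ r s₂ Y.den).hom := by
      rw [← h₁]; simp
    simp [this]
  · have e₁ : σ.hom ▷ t = (α_ _ _ _).hom ≫ r ◁ θ.hom ≫ (α_ _ _ _).inv := by rw [h₂]; simp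
    have e₂ : r ◁ ((β₁ ≫ s₁ ◁ γ ≫ (α_ _ _ _).inv) ≫ θ.hom ▷ Y'.num) =
      r ◁ (β₂ ≫ s₂ ◁ γ ≫ (α_ _ _ _).inv) := congrArg (r ◁ ·) hn
    rw [← cancel_mono ((r ≫ s₂) ◁ γ)]
    calc
      _ = r ◁ β₁ ≫ (α_ _ _ _).inv ≫ σ.hom ▷ Y.num ≫ (r ≫ s₂) ◁ γ := by simp
      _ = r ◁ ((β₁ ≫ s₁ ◁ γ ≫ (α_ _ _ _).inv) ≫ θ.hom ▷ Y'.num) ≫ r ◁ (α_ _ _ _).hom ≫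
            (α_ _ _ _).inv := by
        rw [← whisker_exchange, whiskerRight_comp, e₁]; simp
      _ = _ := by rw [e₂]; simp

theorem hasRightCalculusOfFractions (hW : SatisfiesBF W) (c b : C) :
    (cartesian W c b).HasRightCalculusOfFractions where
  exists_rightFraction _ _ φ := by
    obtain ⟨Z, s, k, hs, h⟩ := exists_rightFraction hW φ.f φ.s φ.hs
    exact ⟨⟨s, hs, k⟩, h⟩
  ext _ _ _ f₁ f₂ g hg h := by
    obtain ⟨Z, s, hs, h⟩ := exists_precomp_eq hW f₁ f₂ g hg h
    exact ⟨Z, s, hs, h⟩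

end Span

/-! ### Roofs invert the elements of `W` -/

namespace Roof

open BicatFractions.Span

variable {C : Type u} [Bicategory.{w, v} C] {W : MorphismProperty C} {c b b' : C}

/-- Every roof is, on the nose, given by a span: localization does not change the objects. -/
theorem Q_obj_surjective (R : Roof W c b) : ∃ X : Span W c b, Q.obj X = R :=
  (Localization.Construction.objEquiv _).surjective R

/-- By (BF3), composition of roofs with an element of `W` is essentially surjective. -/
theorem essSurj_postcomp (hW : SatisfiesBF W) {k : b ⟶ b'} (hk : W k) :
    (postcomp (W := W) (c := c) k).EssSurj where
  mem_essImage R := by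
    obtain ⟨Y, rfl⟩ := Q_obj_surjective R
    obtain ⟨d, r, f, hr, ⟨ι⟩⟩ := hW.bf3 k Y.num hk
    let X : Span W c b := ⟨d, r ≫ Y.den, hW.bf2 _ _ hr Y.den_mem, f⟩
    let φ : RawHom (X.withNum (X.num ≫ k)) Y := ⟨r, Iso.refl _, ι.inv⟩
    exact ⟨Q.obj X, ⟨Localization.Construction.wIso (homMk φ)
      ⟨φ, rfl, inferInstanceAs (IsIso ι.inv)⟩⟩⟩

/-- By (BF4a), a fraction between the images of two spans under composition with an element of `W`
is, up to refinement, the image of a fraction. -/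
theorem exists_lift_fraction (hW : SatisfiesBF W) {k : b ⟶ b'} (hk : W k) {X Y : Span W c b}
    {Z : Span W c b'} (m : RawHom Z (X.withNum (X.num ≫ k))) (hm : IsIso m.numHom)
    (f : RawHom Z (Y.withNum (Y.num ≫ k))) :
    ∃ (X' : Span W c b) (t : X' ⟶ X) (g : X' ⟶ Y) (q : (push k).obj X' ⟶ Z),
      cartesian W c b t ∧ q ≫ homMk m = (push k).map t ∧ q ≫ homMk f = (push k).map g := by
  obtain ⟨(r : Z.apex ⟶ X.apex), (ξ : Z.den ≅ r ≫ X.den), (γ : Z.num ⟶ r ≫ X.num ≫ k)⟩ := m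
  obtain ⟨(s : Z.apex ⟶ Y.apex), (ζ : Z.den ≅ s ≫ Y.den), (β : Z.num ⟶ s ≫ Y.num ≫ k)⟩ := f
  replace hm : IsIso γ := hm
  -- The 2-morphism lifted here is the comparison of the two numerators obtained by inverting the
  -- numerator part of the denominator `m` of the fraction.
  obtain ⟨d, u, δ, hu, hδ⟩ := hW.bf4a k (r ≫ X.num) (s ≫ Y.num)
    ((α_ r X.num k).hom ≫ inv γ ≫ β ≫ (α_ s Y.num k).inv) hk
  have hr : W ((u ≫ r) ≫ X.den) :=
    hW.bf5 _ _ (α_ _ _ _ ≪≫ whiskerLeftIso u ξ.symm) (hW.bf2 _ _ hu Z.den_mem)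
  let g : RawHom (X.restrict (u ≫ r) hr) Y :=
    ⟨u ≫ s, α_ _ _ _ ≪≫ whiskerLeftIso u (ξ.symm ≪≫ ζ) ≪≫ (α_ _ _ _).symm,
      (α_ _ _ _).hom ≫ δ ≫ (α_ _ _ _).inv⟩
  let q : RawHom ((X.restrict (u ≫ r) hr).withNum (((u ≫ r) ≫ X.num) ≫ k)) Z :=
    ⟨u, α_ _ _ _ ≪≫ whiskerLeftIso u ξ.symm,
      (α_ _ _ _).hom ≫ (α_ _ _ _).hom ≫ u ◁ inv γ⟩
  refine ⟨_, _, homMk g, homMk q, X.cartesian_restrict _ hr, ?_, ?_⟩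
  · refine Quotient.sound (RawHom.rel_of_eq
      (?_ : ((α_ _ _ _ ≪≫ whiskerLeftIso u ξ.symm) ≪≫ whiskerLeftIso u ξ ≪≫ (α_ _ _ _).symm).hom =
        𝟙 _)
      (?_ : ((α_ _ _ _).hom ≫ (α_ _ _ _).hom ≫ u ◁ inv γ) ≫ u ◁ γ ≫ (α_ _ _ _).inv =
        (𝟙 _) ▷ k ≫ (α_ _ _ _).hom))
    · simp
    · simp [← whiskerLeft_comp_assoc]
  · have : δ ▷ k = (α_ _ _ _).hom ≫ u ◁ ((α_ r X.num k).hom ≫ inv γ ≫ β ≫ (α_ s Y.num k).inv) ≫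
        (α_ _ _ _).inv := by
      rw [hδ]; simp
    refine Quotient.sound (RawHom.rel_of_eq
      (?_ : ((α_ _ _ _ ≪≫ whiskerLeftIso u ξ.symm) ≪≫ whiskerLeftIso u ζ ≪≫ (α_ _ _ _).symm).hom =
        (α_ _ _ _ ≪≫ whiskerLeftIso u (ξ.symm ≪≫ ζ) ≪≫ (α_ _ _ _).symm).hom)
      (?_ : ((α_ _ _ _).hom ≫ (α_ _ _ _).hom ≫ u ◁ inv γ) ≫ u ◁ β ≫ (α_ _ _ _).inv =
        ((α_ _ _ _).hom ≫ δ ≫ (α_ _ _ _).inv) ▷ k ≫ (α_ _ _ _).hom))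
    · simp
    · simp [this]

/-- Composition of roofs with an element of `W` is full: a morphism between images is a right
fraction, whose two legs lift after refinement by `exists_lift_fraction`. -/
theorem full_postcomp (hW : SatisfiesBF W) {k : b ⟶ b'} (hk : W k) :
    (postcomp (W := W) (c := c) k).Full where
  map_surjective {R R'} g := by
    have := hasRightCalculusOfFractions hW c b'
    obtain ⟨X, rfl⟩ := Q_obj_surjective R
    obtain ⟨Y, rfl⟩ := Q_obj_surjective R'
    obtain ⟨φ, hg⟩ := Localization.exists_rightFraction Q (cartesian W c b')
      (X := (push k).obj X) (Y := (push k).obj Y) g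
    have hφ := φ.map_s_comp_map Q (Localization.inverts Q (cartesian W c b'))
    rw [← hg] at hφ
    obtain ⟨m, hs, hm⟩ := φ.hs
    obtain ⟨f, hf⟩ := homMk_surjective φ.f
    obtain ⟨X', t, g', q, ht, e₁, e₂⟩ := exists_lift_fraction hW hk m hm f
    replace e₁ : Q.map q ≫ Q.map φ.s = Q.map ((push k).map t) :=
      (Q.map_comp _ _).symm.trans (congrArg Q.map ((congrArg (q ≫ ·) hs.symm).trans e₁))
    replace e₂ : Q.map q ≫ Q.map φ.f = Q.map ((push k).map g') :=
      (Q.map_comp _ _).symm.trans (congrArg Q.map ((congrArg (q ≫ ·) hf.symm).trans e₂))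
    have ht : IsIso (Q.map t) := MorphismProperty.Q_inverts _ t ht
    refine ⟨inv (Q.map t) ≫ Q.map g', ?_⟩
    rw [← cancel_epi ((postcomp k).map (Q.map t)), ← CategoryTheory.Functor.map_comp,
      IsIso.hom_inv_id_assoc, postcomp_map_Q, postcomp_map_Q, ← e₁, ← e₂]
    exact (congrArg (_ ≫ ·) hφ.symm).trans (Category.assoc _ _ _).symm

/-- By (BF4c), two morphisms of spans whose images under composition with an element of `W` agree
after composition with a cartesian morphism agree themselves after restriction. -/
theorem exists_cartesian_comp_eq (hW : SatisfiesBF W) {k : b ⟶ b'} (hk : W k) {X Y : Span W c b}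
    {Z : Span W c b'} (φ₁ φ₂ : RawHom X Y) (m : RawHom Z (X.withNum (X.num ≫ k)))
    (hm : IsIso m.numHom) (h : homMk m ≫ homMk (φ₁.push k) = homMk m ≫ homMk (φ₂.push k)) :
    ∃ (X' : Span W c b) (t : X' ⟶ X), cartesian W c b t ∧ t ≫ homMk φ₁ = t ≫ homMk φ₂ := by
  obtain ⟨s₁, ζ₁, β₁⟩ := φ₁
  obtain ⟨s₂, ζ₂, β₂⟩ := φ₂
  obtain ⟨(r : Z.apex ⟶ X.apex), (ξ : Z.den ≅ r ≫ X.den), (γ : Z.num ⟶ r ≫ X.num ≫ k)⟩ := m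
  replace hm : IsIso γ := hm
  obtain ⟨(σ : r ≫ s₁ ≅ r ≫ s₂), hd, hn⟩ := homMk_eq_iff.1 h
  replace hd : (ξ.hom ≫ r ◁ ζ₁.hom ≫ (α_ _ _ _).inv) ≫ σ.hom ▷ Y.den =
    ξ.hom ≫ r ◁ ζ₂.hom ≫ (α_ _ _ _).inv := hd
  replace hn : (γ ≫ r ◁ (β₁ ▷ k ≫ (α_ _ _ _).hom) ≫ (α_ _ _ _).inv) ≫ σ.hom ▷ (Y.num ≫ k) =
    γ ≫ r ◁ (β₂ ▷ k ≫ (α_ _ _ _).hom) ≫ (α_ _ _ _).inv := hn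
  rw [Category.assoc, cancel_epi] at hd hn
  have key : (r ◁ β₁ ≫ (α_ _ _ _).inv ≫ σ.hom ▷ Y.num) ▷ k = (r ◁ β₂ ≫ (α_ _ _ _).inv) ▷ k := by
    rw [← cancel_epi (α_ _ _ _).inv, ← cancel_mono (α_ _ _ _).hom]
    simpa using hn
  obtain ⟨d, z, hz, hzk⟩ := hW.exists_whiskerLeft_eq hk key
  have hr : W ((z ≫ r) ≫ X.den) :=
    hW.bf5 _ _ (α_ _ _ _ ≪≫ whiskerLeftIso z ξ.symm) (hW.bf2 _ _ hz Z.den_mem)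
  refine ⟨_, _, X.cartesian_restrict (z ≫ r) hr,
    homMk_eq_iff.2 ⟨α_ _ _ _ ≪≫ whiskerLeftIso z σ ≪≫ (α_ _ _ _).symm, ?_, ?_⟩⟩
  · have := congrArg (z ◁ ·) hd
    simp only [whiskerLeft_comp, Category.assoc] at this
    simp [reassoc_of% this]
  · simp only [whiskerLeft_comp] at hzk
    simp [reassoc_of% hzk]

/-- Faithfulness of composition with an element of `W`, for morphisms of roofs that come from
morphisms of spans. -/
theorem Q_map_eq_of_push (hW : SatisfiesBF W) {k : b ⟶ b'} (hk : W k) {X Y : Span W c b}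
    (f₁ f₂ : X ⟶ Y) (h : Q.map ((push k).map f₁) = Q.map ((push k).map f₂)) :
    Q.map f₁ = Q.map f₂ := by
  have := hasRightCalculusOfFractions hW c b'
  have := hasRightCalculusOfFractions hW c b
  obtain ⟨Z, _, ⟨m, rfl, hm⟩, H⟩ :=
    (MorphismProperty.map_eq_iff_precomp Q (cartesian W c b') _ _).1 h
  obtain ⟨φ₁, rfl⟩ := homMk_surjective f₁
  obtain ⟨φ₂, rfl⟩ := homMk_surjective f₂
  obtain ⟨X', t, ht, H'⟩ := exists_cartesian_comp_eq hW hk φ₁ φ₂ m hm H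
  exact (MorphismProperty.map_eq_iff_precomp Q (cartesian W c b) _ _).2 ⟨X', t, ht, H'⟩

theorem faithful_postcomp (hW : SatisfiesBF W) {k : b ⟶ b'} (hk : W k) :
    (postcomp (W := W) (c := c) k).Faithful where
  map_injective {R R'} g₁ g₂ h := by
    have := hasRightCalculusOfFractions hW c b
    obtain ⟨X, rfl⟩ := Q_obj_surjective R
    obtain ⟨Y, rfl⟩ := Q_obj_surjective R'
    -- Right fractions turn a parallel pair of morphisms of roofs into a pair that comes from spans.
    obtain ⟨φ, hφ⟩ := Localization.exists_rightFraction Q (cartesian W c b) g₁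
    obtain ⟨ψ, hψ⟩ := Localization.exists_rightFraction Q (cartesian W c b) (Q.map φ.s ≫ g₂)
    have e₁ := φ.map_s_comp_map Q (Localization.inverts Q (cartesian W c b))
    have e₂ := ψ.map_s_comp_map Q (Localization.inverts Q (cartesian W c b))
    rw [← hφ] at e₁
    rw [← hψ] at e₂
    have : IsIso (Q.map φ.s) := MorphismProperty.Q_inverts _ _ φ.hs
    have : IsIso (Q.map ψ.s) := MorphismProperty.Q_inverts _ _ ψ.hs
    rw [← cancel_epi (Q.map φ.s), ← cancel_epi (Q.map ψ.s), e₁, e₂, ← Functor.map_comp]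
    refine Q_map_eq_of_push hW hk _ _ ?_
    rw [← postcomp_map_Q, ← postcomp_map_Q]
    have e₃ : Q.map (ψ.s ≫ φ.f) = Q.map ψ.s ≫ Q.map φ.s ≫ g₁ := by
      rw [e₁, CategoryTheory.Functor.map_comp]
    have e₄ : (postcomp k).map (Q.map φ.s ≫ g₁) = (postcomp k).map (Q.map φ.s ≫ g₂) := by
      rw [CategoryTheory.Functor.map_comp, CategoryTheory.Functor.map_comp, h]
    rw [e₃, ← e₂]
    exact ((postcomp k).map_comp _ _).trans ((congrArg ((postcomp k).map (Q.map ψ.s) ≫ ·) e₄).trans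
      ((postcomp k).map_comp _ _).symm)

theorem isInternalEquivalence_pseudofunctor_map (hW : SatisfiesBF W) (c : C) {k : b ⟶ b'}
    (hk : W k) : IsInternalEquivalence ((pseudofunctor W c).map k) := by
  have := essSurj_postcomp (c := c) hW hk
  have := full_postcomp (c := c) hW hk
  have := faithful_postcomp (c := c) hW hk
  have : (postcomp (W := W) (c := c) k).IsEquivalence := {}
  let e := (postcomp (W := W) (c := c) k).asEquivalence
  exact ⟨e.inverse.toCatHom, ⟨Cat.Hom.isoMk e.unitIso⟩, ⟨Cat.Hom.isoMk e.counitIso⟩⟩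

/-- Being invertible on numerators does not depend on the representative. -/
theorem isIso_numHom_of_cartesian {X Y : Span W c b} {φ : RawHom X Y}
    (h : cartesian W c b (homMk φ)) : IsIso φ.numHom := by
  obtain ⟨ψ, h, _⟩ := h
  obtain ⟨σ, -, hn⟩ := homMk_eq_iff.1 h
  rw [← hn]
  infer_instance

/-- A morphism of spans that becomes invertible between roofs has a left factor making it
cartesian. -/
theorem exists_cartesian_comp (hW : SatisfiesBF W) {X Y : Span W c b} (f : X ⟶ Y)
    (h : IsIso (Q.map f)) : ∃ (Z : Span W c b) (g : Z ⟶ X), cartesian W c b (g ≫ f) := by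
  have := hasRightCalculusOfFractions hW c b
  obtain ⟨φ, hφ⟩ := Localization.exists_rightFraction Q (cartesian W c b) (inv (Q.map f))
  have e := φ.map_s_comp_map Q (Localization.inverts Q (cartesian W c b))
  rw [← hφ, IsIso.comp_inv_eq, ← Functor.map_comp] at e
  obtain ⟨Z, m, hm, H⟩ := (MorphismProperty.map_eq_iff_precomp Q (cartesian W c b) _ _).1 e
  refine ⟨Z, m ≫ φ.f, ?_⟩
  rw [Category.assoc, ← H]
  exact (cartesian W c b).comp_mem _ _ hm φ.hs

/-- A morphism of spans that becomes invertible between roofs is invertible on numerators after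
restriction to another span. -/
theorem exists_isIso_whiskerLeft_numHom (hW : SatisfiesBF W) {X Y : Span W c b} (φ : RawHom X Y)
    (h : IsIso (Q.map (homMk φ))) :
    ∃ (e : C) (r : e ⟶ X.apex), W (r ≫ X.den) ∧ IsIso (r ◁ φ.numHom) := by
  obtain ⟨Z, f, hf⟩ := exists_cartesian_comp hW _ h
  have hf' : IsIso (Q.map (f ≫ homMk φ)) := MorphismProperty.Q_inverts _ _ hf
  rw [Functor.map_comp] at hf'
  obtain ⟨Z', g, hg⟩ := exists_cartesian_comp hW f (IsIso.of_isIso_comp_right _ (Q.map (homMk φ)))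
  obtain ⟨⟨r, ξ, γ⟩, rfl⟩ := homMk_surjective f
  obtain ⟨⟨a, ζ, β⟩, rfl⟩ := homMk_surjective g
  have h₁ : IsIso (γ ≫ r ◁ φ.numHom ≫ (α_ _ _ _).inv) := isIso_numHom_of_cartesian hf
  have h₂ : IsIso (β ≫ a ◁ γ ≫ (α_ _ _ _).inv) := isIso_numHom_of_cartesian hg
  -- The 2-morphism `a ◁ γ` has a left inverse because of `h₁` and a right inverse because of `h₂`.
  rw [← Category.assoc] at h₁ h₂
  replace h₁ : IsIso (γ ≫ r ◁ φ.numHom) := IsIso.of_isIso_comp_right _ (α_ _ _ _).inv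
  replace h₂ : IsIso (β ≫ a ◁ γ) := IsIso.of_isIso_comp_right _ (α_ _ _ _).inv
  have h₃ : IsIso (a ◁ γ ≫ a ◁ r ◁ φ.numHom) := by
    rw [← whiskerLeft_comp]
    infer_instance
  have : IsSplitMono (a ◁ γ) := ⟨⟨⟨a ◁ r ◁ φ.numHom ≫ inv (a ◁ γ ≫ a ◁ r ◁ φ.numHom), by
    rw [← Category.assoc, IsIso.hom_inv_id]⟩⟩⟩
  have : IsSplitEpi (a ◁ γ) := ⟨⟨⟨inv (β ≫ a ◁ γ) ≫ β, by
    rw [Category.assoc, IsIso.inv_hom_id]⟩⟩⟩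
  have : IsIso (a ◁ γ) := isIso_of_epi_of_isSplitMono _
  have : IsIso (a ◁ r ◁ φ.numHom) := IsIso.of_isIso_comp_left (a ◁ γ) _
  refine ⟨_, a ≫ r, hW.bf5 _ _ (α_ _ _ _ ≪≫ whiskerLeftIso a ξ.symm ≪≫ ζ.symm) Z'.den_mem, ?_⟩
  rw [comp_whiskerLeft]
  infer_instance

/-- A 1-morphism whose composition with roofs is an equivalence is a last factor of an element of
`W`. Essential surjectivity at the identity roof of `c` yields a span `X` such that composing its
numerator with `f` gives a roof isomorphic to the identity; after refinement both legs of a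
fraction representing this isomorphism are invertible on numerators. -/
theorem exists_comp_mem (hW : SatisfiesBF W) {f : b ⟶ c}
    (hf : IsInternalEquivalence ((pseudofunctor W c).map f)) :
    ∃ (d : C) (g : d ⟶ b), W (g ≫ f) := by
  obtain ⟨f', -, ⟨θ⟩⟩ := hf
  let Y : Span W c c := ⟨c, 𝟙 c, hW.bf1 c, 𝟙 c⟩
  obtain ⟨X, hX⟩ := Q_obj_surjective (W := W) (c := c) (f'.toFunctor.obj (Q.obj Y))
  let i : Q.obj ((push f).obj X) ≅ Q.obj Y :=
    (postcomp f).mapIso (eqToIso hX) ≪≫ (Cat.Hom.toNatIso θ).app (Q.obj Y)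
  have := hasRightCalculusOfFractions hW c c
  obtain ⟨φ, hφ⟩ := Localization.exists_rightFraction Q (cartesian W c c) i.hom
  have e := φ.map_s_comp_map Q (Localization.inverts Q (cartesian W c c))
  rw [← hφ] at e
  have : IsIso (Q.map φ.s) := MorphismProperty.Q_inverts _ _ φ.hs
  have hf : IsIso (Q.map φ.f) := by rw [← e]; infer_instance
  obtain ⟨⟨r, ξ, γ⟩, hs, hγ⟩ := φ.hs
  obtain ⟨⟨s, ζ, β⟩, hβ⟩ := homMk_surjective φ.f
  replace hγ : IsIso γ := hγ
  rw [← hβ] at hf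
  obtain ⟨d, q, hq, hqβ⟩ := exists_isIso_whiskerLeft_numHom hW _ hf
  replace hqβ : IsIso (q ◁ β) := hqβ
  exact ⟨d, q ≫ r ≫ X.num, hW.bf5 _ _ ((α_ _ _ _ ≪≫ whiskerLeftIso q (α_ _ _ _)) ≪≫
    whiskerLeftIso q (asIso γ).symm ≪≫ asIso (q ◁ β) ≪≫ whiskerLeftIso q ζ.symm) hq⟩

end Roof

/-! ### Internal equivalences in the bicategory of fractions -/

section

variable {C : Type u} [Bicategory.{w, v} C] {W : MorphismProperty C}

/-- The pseudofunctor of roofs extends to the bicategory of fractions, hence it sends `f` to an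
equivalence as soon as the localization does. -/
theorem exists_comp_mem_of_localize (hW : SatisfiesBF W) {b c : C} {f : b ⟶ c}
    (hf : IsInternalEquivalence ((Fractions.localize W).map f)) :
    ∃ (d : C) (g : d ⟶ b), W (g ≫ f) := by
  obtain ⟨G, κ, hκ⟩ := Fractions.exists_extension (W := W) (Roof.pseudofunctor W c)
    fun _ _ _ hk => Roof.isInternalEquivalence_pseudofunctor_map hW c hk
  exact Roof.exists_comp_mem hW (.map_of_trans hκ (hf.map G))

/-- The saturation of `W` consists of the 1-morphisms that become internal equivalences in the
bicategory of fractions. -/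
theorem isInternalEquivalence_localize_iff (hW : SatisfiesBF W) {b c : C} {f : b ⟶ c} :
    IsInternalEquivalence ((Fractions.localize W).map f) ↔ rightSaturation W f := by
  refine ⟨fun hf => ?_, fun hf => .map_of_rightSaturation _
    (fun _ _ => Fractions.isInternalEquivalence_localize W) hf⟩
  -- A 1-morphism `g` with `g ≫ f` in `W` is itself inverted, so the same argument applies to `g`.
  obtain ⟨d, g, hgf⟩ := exists_comp_mem_of_localize hW hf
  have hg : IsInternalEquivalence ((Fractions.localize W).map g) :=
    .of_comp_right hf ((Fractions.isInternalEquivalence_localize W _ hgf).of_iso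
      ((Fractions.localize W).mapComp g f))
  obtain ⟨e, h, hhg⟩ := exists_comp_mem_of_localize hW hg
  exact ⟨d, e, g, h, hgf, hhg⟩

/-- (BF5) is needed because composites with identities are not strict. -/
theorem rightSaturation_of_mem (hW : SatisfiesBF W) {b c : C} {f : b ⟶ c} (hf : W f) :
    rightSaturation W f :=
  ⟨b, b, 𝟙 b, 𝟙 b, hW.bf5 _ _ (λ_ f) hf, hW.bf5 _ _ (λ_ (𝟙 b)) (hW.bf1 b)⟩

end

end BicatFractions

theorem mainTheorem1 {A : Type u₁} [Bicategory.{w₁, v₁} A] {B : Type u₂} [Bicategory.{w₂, v₂} B]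
    (WA : MorphismProperty A) (WB : MorphismProperty B)
    (hA : SatisfiesBF WA) (hB : SatisfiesBF WB) (F : A ⥤ᵖ B) :
    List.TFAE [
      ∀ ⦃a b : A⦄ (f : a ⟶ b), WA f → rightSaturation WB (F.map f),
      ∀ ⦃a b : A⦄ (f : a ⟶ b), rightSaturation WA f → rightSaturation WB (F.map f),
      ∃ (G : Fractions WA ⥤ᵖ Fractions WB)
        (κ : F.comp (Fractions.localize WB) ⟶ (Fractions.localize WA).comp G),
        IsInternalEquivalence κ,
      ∃ (G : Fractions WA ⥤ᵖ Fractions WB)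
        (κ : F.comp (Fractions.localize WB) ⟶ (Fractions.localize WA).comp G),
        IsInternalEquivalence κ ∧
          ∀ ⦃a b : A⦄ (f : a ⟶ b), WA f →
            IsInternalEquivalence ((cylinderPseudofunctor κ).map f)] := by
  have hsat : ∀ {a b : A} (f : a ⟶ b),
      IsInternalEquivalence ((F.comp (Fractions.localize WB)).map f) ↔
        rightSaturation WB (F.map f) := fun f => isInternalEquivalence_localize_iff hB
  tfae_have 1 → 2 := fun h a b f hf => (hsat f).1
    (.map_of_rightSaturation _ (fun _ _ g hg => (hsat g).2 (h g hg)) hf)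
  tfae_have 2 → 1 := fun h a b f hf => h f (rightSaturation_of_mem hA hf)
  tfae_have 1 → 3 := fun h => Fractions.exists_extension _ fun _ _ g hg => (hsat g).2 (h g hg)
  tfae_have 3 → 4 := by
    rintro ⟨G, κ, hκ⟩
    refine ⟨G, κ, hκ, fun a b f hf => ?_⟩
    have h : IsInternalEquivalence (((Fractions.localize WA).comp G).map f) :=
      (Fractions.isInternalEquivalence_localize WA f hf).map G
    exact .cyl (s := ((cylinderPseudofunctor κ).obj a)) (t := ((cylinderPseudofunctor κ).obj b))
      (.map_of_trans hκ h) h (κ.naturality f)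
  tfae_have 4 → 1 := by
    rintro ⟨G, κ, hκ, -⟩ a b f hf
    exact (hsat f).1
      (.map_of_trans hκ ((Fractions.isInternalEquivalence_localize WA f hf).map G))
  tfae_finish
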